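/- **Setting.** Let $\Theta\subseteq\mathbb R$ be open and let $\{f(x;\theta):\theta\in\Theta\}$ be a regular family of densities with respect to a $\sigma$-finite measure $\nu$ on a space $X$: $f(x;\theta)>0$ on the common support $X$, $\int f(x;\theta)\,d\nu(x)=1$, $\theta\mapsto f(x;\theta)$ is $C^\infty$ on $\Theta$ for every $x$, and all derivatives $f^{(k)}(x;\theta)=\partial_\theta^k f(x;\theta)$ are $\nu$-integrable in $x$ with $\int f^{(k)}(x;\theta)\,d\nu(x)=0$ for $k\ge1$. Let $\mathcal Q=\{Q(\cdot\,;\vartheta,\varepsilon):\vartheta\in\Theta,\ \varepsilon>0\}$ be a family of proper dispersion models on $\Theta$: $Q(\cdot\,;\vartheta,\varepsilon)$ is the probability distribution on $\Theta$ with Lebesgue density $$a(\varepsilon)\,V(\theta)^{-1/2}\exp\{-d(\theta,\vartheta)/(2\varepsilon)\},\qquad V(\theta)=2\Big(\tfrac{\partial^2 d}{\partial\theta^2}(\theta,\theta)\Big)^{-1},$$ where $d(\theta,\theta)=0$, $d(\theta,\vartheta)>0$ for $\theta\ne\vartheta$ and $\frac{\partial^2 d}{\partial\theta^2}(\theta,\theta)>0$.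 Assume that $d$ is three times continuously differentiable on $\Theta\times\Theta$, and that for every $\vartheta\in\Theta$ and $\delta>0$ one has $\inf\{d(\theta,\vartheta):\theta\in\Theta,\ |\theta-\vartheta|\ge\delta\}>0$. Let $r\ge1$, and assume that for every $\vartheta\in\Theta$ the distribution $Q(\cdot\,;\vartheta,\varepsilon)$ has a finite moment of order $2r$ for some $\varepsilon>0$. Write $g(x;Q)=\int f(x;\theta)\,dQ(\theta)$ and $u(i)=\lfloor (i+1)/2\rfloor$; below $Q=Q(\cdot\,;\vartheta,\varepsilon)$. **Theorem.** For all $\vartheta\in\Theta$, $\varepsilon>0$ and $x$, $$g(x;Q)=\frac{\int_\Theta f(x;\theta)V(\theta)^{-1/2}e^{-d(\theta,\vartheta)/(2\varepsilon)}\,d\theta}{\int_\Theta V(\theta)^{-1/2}e^{-d(\theta,\vartheta)/(2\varepsilon)}\,d\theta}.$$ Moreover, there are functions $A_i(\vartheta,\varepsilon)$ $(1\le i\le 2r)$ and $M_i(\vartheta,\varepsilon)$ $(1\le i\le 2r)$ such that the following hold for each fixed $\vartheta\in\Theta$ as $\varepsilon\to0^+$. 1. For $1\le i\le 2r$: $A_i(\vartheta,\varepsilon)=O(\varepsilon^{u(i)})$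 and $\dfrac{E_Q[(\theta-\vartheta)^i]}{i!}=A_i(\vartheta,\varepsilon)+O(\varepsilon^{r+1})$. 2. $M_1(\vartheta,\varepsilon)\in\Theta$ for all small $\varepsilon$, $E_Q[\theta]=M_1(\vartheta,\varepsilon)+O(\varepsilon^{r+1})$ and $M_1(\vartheta,\varepsilon)=\vartheta+A_1(\vartheta,\varepsilon)+O(\varepsilon^3)$. 3. For $2\le i\le 2r$: $M_i(\vartheta,\varepsilon)=O(\varepsilon^{u(i)})$ and $\dfrac{E_Q[(\theta-E_Q[\theta])^i]}{i!}=M_i(\vartheta,\varepsilon)+O(\varepsilon^{r+1})$. 4. For every fixed $x$ for which $f(x;\cdot)$ is $Q(\cdot\,;\vartheta,\varepsilon)$-integrable for some $\varepsilon>0$, $$g(x;Q)=f(x;\vartheta)+\sum_{i=1}^{2r}A_i(\vartheta,\varepsilon)f^{(i)}(x;\vartheta)+O(\varepsilon^{r+1}),$$ $$g(x;Q)=f(x;M_1(\vartheta,\varepsilon))+\sum_{i=2}^{2r}M_i(\vartheta,\varepsilon)f^{(i)}(x;M_1(\vartheta,\varepsilon))+O(\varepsilon^{r+1}).$$ 5.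 If $f$ and each of its derivatives $f^{(k)}$ is bounded on $X\times\Theta$, then both expansions in 4 hold uniformly in $x$: the constant in $O(\varepsilon^{r+1})$ and the range of $\varepsilon$ do not depend on $x$. -/

import Mathlib

open MeasureTheory Asymptotics Filter
open scoped Topology ContDiff

noncomputable section

namespace LocalMixture

/-- A regular one-parameter family `{f(x; θ) : θ ∈ Θ}` of probability densities with respect to `ν`:
`Θ` is open, the densities have the common support `X`, depend smoothly on `θ`, and differentiation
in `θ` commutes with integration in `x` (so that all `θ`-derivatives integrate to zero). -/
structure IsRegularFamily {X : Type*} [MeasurableSpace X] (ν : Measure X) (Θ : Set ℝ)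
    (f : X → ℝ → ℝ) : Prop where
  isOpen : IsOpen Θ
  measurable : ∀ θ ∈ Θ, Measurable fun x => f x θ
  pos : ∀ x, ∀ θ ∈ Θ, 0 < f x θ
  integral_eq_one : ∀ θ ∈ Θ, ∫ x, f x θ ∂ν = 1
  smooth : ∀ x, ContDiffOn ℝ ∞ (f x) Θ
  integrable_deriv : ∀ k : ℕ, ∀ θ ∈ Θ, Integrable (fun x => iteratedDeriv k (f x) θ) ν
  integral_deriv : ∀ k : ℕ, 1 ≤ k → ∀ θ ∈ Θ, ∫ x, iteratedDeriv k (f x) θ ∂ν = 0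

/-- The unit variance function `V(μ) = 2 (∂²d/∂μ² (μ, μ))⁻¹` of a unit deviance `d(μ; m)`;
the derivative is taken in the first argument. -/
def unitVariance (d : ℝ → ℝ → ℝ) (μ : ℝ) : ℝ :=
  2 * (iteratedDeriv 2 (fun s => d s μ) μ)⁻¹

/-- The unnormalized dispersion density `V(μ)^(-1/2) exp(-d(μ; m) / (2ε))`. -/
def dispersionKernel (d : ℝ → ℝ → ℝ) (m ε μ : ℝ) : ℝ :=
  unitVariance d μ ^ (-1 / 2 : ℝ) * Real.exp (-(d μ m) / (2 * ε))

/-- The distribution on `Θ` with Lebesgue density `a(ε) V(μ)^(-1/2) exp(-d(μ; m) / (2ε))`. -/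
def dispersionLaw (Θ : Set ℝ) (d : ℝ → ℝ → ℝ) (a : ℝ → ℝ) (m ε : ℝ) : Measure ℝ :=
  (volume.restrict Θ).withDensity fun μ => ENNReal.ofReal (a ε * dispersionKernel d m ε μ)

/-- A family of proper dispersion models on `Θ`: a twice continuously differentiable unit deviance
`d ≥ 0`, vanishing exactly on the diagonal with positive second derivative there, and a factor
`a(ε)`, free of the position parameter, which normalizes the density. -/
structure IsProperDispersionModel (Θ : Set ℝ) (d : ℝ → ℝ → ℝ) (a : ℝ → ℝ) : Prop where
  contDiff : ContDiffOn ℝ 2 (Function.uncurry d) (Θ ×ˢ Θ)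
  diag : ∀ μ ∈ Θ, d μ μ = 0
  pos : ∀ μ ∈ Θ, ∀ m ∈ Θ, μ ≠ m → 0 < d μ m
  deriv_pos : ∀ μ ∈ Θ, 0 < iteratedDeriv 2 (fun s => d s μ) μ
  isProbability : ∀ m ∈ Θ, ∀ ε > 0, IsProbabilityMeasure (dispersionLaw Θ d a m ε)

/-- The mixture density `g(x; Q) = ∫ f(x; θ) dQ(θ)`. -/
def mixture {X : Type*} (f : X → ℝ → ℝ) (Q : Measure ℝ) (x : X) : ℝ :=
  ∫ θ, f x θ ∂Q

/-- The mean `E_Q[θ]`. -/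
def mean (Q : Measure ℝ) : ℝ := ∫ θ, θ ∂Q

/-- The scaled moment `E_Q[(θ - c)^i] / i!` about the point `c`. -/
def scaledMoment (Q : Measure ℝ) (c : ℝ) (i : ℕ) : ℝ :=
  (∫ θ, (θ - c) ^ i ∂Q) / (i.factorial : ℝ)

/-- The difference between the mixture density at `x` and the local expansion
`f(x; c) + ∑_{i = k}^{n} B_i f^{(i)}(x; c)` centred at `c`. -/
def expansionError {X : Type*} (f : X → ℝ → ℝ) (Q : Measure ℝ) (k n : ℕ) (c : ℝ) (B : ℕ → ℝ)
    (x : X) : ℝ :=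
  mixture f Q x - (f x c + ∑ i ∈ Finset.Icc k n, B i * iteratedDeriv i (f x) c)

end LocalMixture

end

/-! The theorem is Taylor's formula for `f x` integrated against `Q`, with the exact scaled moments
about `ϑ` as `A i`, the mean as `M 1` and the exact scaled central moments as the other `M i`. What
needs proof is how fast these moments vanish, and that is Laplace's method.

Near `ϑ` the density is Gaussian with variance of order `ε`, up to a relative error of size `√ε`. An
even moment of order `n` is therefore `O(ε^(n/2))`. In an odd one the Gaussian part cancels by
symmetry and the error supplies another `√ε`, so the order is `ε^((n+1)/2)` (`exists_abs_moment_le`,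
normalized through `exists_normalizer_le`). Away from `ϑ` the deviance is bounded below, and
comparison with one fixed dispersion gives exponential decay (`isBigO_setIntegral_compl_ball`).
`IsConcentrating` collects these facts, and the moment estimates use nothing else about the laws.

Moments of order above `2r` may fail to exist, so Taylor's formula is used only on a ball, to degree
`2r+1` with a remainder of degree `2r+2`; outside, `F` and its Taylor polynomial are bounded
separately (`abs_integral_sub_taylor_le`). Both additional terms are `O(ε^(r+1))`, the odd one
because of the cancellation. Replacing `ϑ` by the mean moves the centre by `O(ε)` only, which
preserves all orders (`isBigO_ball_moment`). -/

namespace LocalMixture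

/-! ### Taylor's formula and Gaussian moments -/

/-- The derivative of the remainder of `F` is the remainder of `deriv F` of one degree less, so the
mean value inequality gives the induction. The factor `1 / n!` is dropped, since only orders matter
later. -/
theorem abs_sub_taylor_le {U : Set ℝ} (hU : IsOpen U) (hconv : Convex ℝ U) {K c : ℝ} (hc : c ∈ U)
    (n : ℕ) {F : ℝ → ℝ} (hF : ContDiffOn ℝ n F U) (hK : ∀ t ∈ U, |iteratedDeriv n F t| ≤ K)
    {t : ℝ} (ht : t ∈ U) :
    |F t - ∑ i ∈ Finset.range n, iteratedDeriv i F c / (i.factorial : ℝ) * (t - c) ^ i|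
      ≤ K * |t - c| ^ n := by
  induction n generalizing F t with
  | zero => simpa using hK t ht
  | succ n ih =>
    have hK0 : 0 ≤ K := (abs_nonneg _).trans (hK c hc)
    have hF' : ContDiffOn ℝ n (deriv F) U :=
      hF.deriv_of_isOpen hU (by norm_cast)
    have hsub : Set.uIcc c t ⊆ U := by
      rw [← segment_eq_uIcc]; exact hconv.segment_subset hc ht
    have hder : ∀ s ∈ U, HasDerivAt
        (fun t => F t - ∑ i ∈ Finset.range (n + 1),
          iteratedDeriv i F c / (i.factorial : ℝ) * (t - c) ^ i)
        (deriv F s - ∑ i ∈ Finset.range n,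
          iteratedDeriv i (deriv F) c / (i.factorial : ℝ) * (s - c) ^ i) s := by
      intro s hs
      have hFs : HasDerivAt F (deriv F s) s :=
        ((hF.differentiableOn (by simp)).differentiableAt (hU.mem_nhds hs)).hasDerivAt
      refine hFs.sub ?_
      simp only [Finset.sum_range_succ' _ n]
      simp only [pow_zero, mul_one]
      refine HasDerivAt.add_const _ (HasDerivAt.fun_sum fun i _ => ?_)
      have h1 := (((hasDerivAt_id s).sub_const c).pow (i + 1)).const_mul
        (iteratedDeriv (i + 1) F c / ((i + 1).factorial : ℝ))
      refine h1.congr_deriv ?_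
      rw [iteratedDeriv_succ', Nat.factorial_succ]
      have : (i.factorial : ℝ) ≠ 0 := by positivity
      push_cast
      simp only [id, mul_one]
      field_simp
    have hbd := (convex_uIcc c t).norm_image_sub_le_of_norm_hasDerivWithin_le
      (C := K * |t - c| ^ n)
      (fun s hs => (hder s (hsub hs)).hasDerivWithinAt)
      (fun s hs => by
        refine (ih hF' (fun t ht => ?_) (hsub hs)).trans ?_
        · rw [← iteratedDeriv_succ']; exact hK t ht
        · have := Set.abs_sub_left_of_mem_uIcc hs
          gcongr)
      Set.left_mem_uIcc Set.right_mem_uIcc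
    rw [Finset.sum_range_succ' _ n] at hbd
    have h0 : F c - (∑ i ∈ Finset.range n, iteratedDeriv (i + 1) F c / ((i + 1).factorial : ℝ)
        * (c - c) ^ (i + 1) + iteratedDeriv 0 F c / (Nat.factorial 0 : ℝ) * (c - c) ^ 0) = 0 := by
      simp
    simp only [Finset.sum_range_succ' _ n] at hbd ⊢
    rw [h0, sub_zero] at hbd
    simpa [pow_succ, mul_assoc] using hbd

theorem abs_exp_neg_sub_exp_neg_le {a b m : ℝ} (ha : m ≤ a) (hb : m ≤ b) :
    |Real.exp (-a) - Real.exp (-b)| ≤ |a - b| * Real.exp (-m) := by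
  wlog hab : a ≤ b generalizing a b
  · rw [abs_sub_comm, abs_sub_comm a b]; exact this hb ha (le_of_not_ge hab)
  have h1 : Real.exp (-b) ≤ Real.exp (-a) := Real.exp_le_exp.2 (by linarith)
  rw [abs_of_nonneg (by linarith), abs_of_nonpos (by linarith)]
  have h2 : Real.exp (-b) = Real.exp (-a) * Real.exp (-(b - a)) := by
    rw [← Real.exp_add]; congr 1; ring
  have h3 := Real.add_one_le_exp (-(b - a))
  have h4 : Real.exp (-a) ≤ Real.exp (-m) := Real.exp_le_exp.2 (by linarith)
  rw [h2]
  nlinarith [Real.exp_pos (-a)]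

theorem integrable_abs_pow_mul_exp_neg_mul_sq {b : ℝ} (hb : 0 < b) (n : ℕ) :
    Integrable fun s : ℝ => |s| ^ n * Real.exp (-b * s ^ 2) := by
  have h := (integrable_rpow_mul_exp_neg_mul_sq hb (s := (n : ℝ))
    (by have : (0 : ℝ) ≤ n := by positivity
        linarith)).norm
  refine h.congr (Eventually.of_forall fun s => ?_)
  simp

theorem integrable_abs_sub_pow_mul_gaussian {κ ε : ℝ} (hκ : 0 < κ) (hε : 0 < ε) (c : ℝ) (n : ℕ) :
    Integrable fun t : ℝ => |t - c| ^ n * Real.exp (-(κ * (t - c) ^ 2) / (2 * ε)) := by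
  refine ((integrable_abs_pow_mul_exp_neg_mul_sq
    (b := κ / (2 * ε)) (by positivity) n).comp_sub_right c).congr
    (Eventually.of_forall fun t => ?_)
  simp only
  congr 2; ring

/-- Substitution `s = (t - c) / √ε`; the constant is the integral at `ε = 1`. -/
theorem exists_integral_gaussian_eq (κ c : ℝ) (n : ℕ) :
    ∃ C : ℝ, 0 ≤ C ∧ ∀ ε : ℝ, 0 < ε →
      ∫ t : ℝ, |t - c| ^ n * Real.exp (-(κ * (t - c) ^ 2) / (2 * ε)) = C * √ε ^ (n + 1) := by
  refine ⟨∫ s : ℝ, |s| ^ n * Real.exp (-(κ * s ^ 2) / 2),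
    integral_nonneg fun s => by positivity, fun ε hε => ?_⟩
  have hs : 0 < √ε := Real.sqrt_pos.2 hε
  rw [integral_sub_right_eq_self (fun t : ℝ => |t| ^ n * Real.exp (-(κ * t ^ 2) / (2 * ε))) c]
  have h := Measure.integral_comp_div (fun s : ℝ => |s| ^ n * Real.exp (-(κ * s ^ 2) / 2)) (√ε)
  rw [abs_of_pos hs, smul_eq_mul] at h
  have h2 : ∀ t : ℝ, |t| ^ n * Real.exp (-(κ * t ^ 2) / (2 * ε))
      = √ε ^ n * (|t / √ε| ^ n * Real.exp (-(κ * (t / √ε) ^ 2) / 2)) := by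
    intro t
    rw [abs_div, abs_of_pos hs, div_pow, div_pow, Real.sq_sqrt hε.le]
    field_simp
  simp_rw [h2]
  rw [integral_const_mul, h]; ring

theorem setIntegral_ball_odd_eq_zero {g : ℝ → ℝ} (hg : ∀ s, g (-s) = -g s) (c δ : ℝ) :
    ∫ t in Metric.ball c δ, g (t - c) = 0 := by
  rw [← integral_indicator measurableSet_ball]
  have h1 : ∀ t, (Metric.ball c δ).indicator (fun t => g (t - c)) t
      = (Metric.ball 0 δ).indicator g (t - c) := by
    intro t
    simp [Set.indicator, Real.dist_eq, Metric.mem_ball]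
  simp_rw [h1]
  rw [integral_sub_right_eq_self ((Metric.ball (0 : ℝ) δ).indicator g) c]
  have h2 := integral_neg_eq_self ((Metric.ball (0 : ℝ) δ).indicator g) volume
  have h3 : ∀ t, (Metric.ball (0 : ℝ) δ).indicator g (-t)
      = -(Metric.ball (0 : ℝ) δ).indicator g t := by
    intro t
    by_cases h : |t| < δ <;> simp [Set.indicator, h, hg]
  simp_rw [h3] at h2
  rw [integral_neg] at h2
  linarith

/-! ### Laplace's method on a ball around the minimum -/

/-- On the ball of radius `δ` around `ϑ` the phase `D` is a quadratic function up to a cubic error,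
which is at most half as large as the quadratic, and the positive amplitude `w` is constant up to a
linear error, which is at most half as large as the constant. -/
structure IsLaplacePair (D w : ℝ → ℝ) (ϑ α δ C L : ℝ) : Prop where
  curvature_pos : 0 < α
  radius_pos : 0 < δ
  continuousOn_phase : ContinuousOn D (Metric.ball ϑ δ)
  continuousOn_amplitude : ContinuousOn w (Metric.ball ϑ δ)
  phase : ∀ t ∈ Metric.ball ϑ δ, |D t - α * (t - ϑ) ^ 2| ≤ C * |t - ϑ| ^ 3
  cubic_nonneg : 0 ≤ C
  cubic_le : C * δ ≤ α / 2
  amplitude : ∀ t ∈ Metric.ball ϑ δ, |w t - w ϑ| ≤ L * |t - ϑ|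
  linear_nonneg : 0 ≤ L
  amplitude_pos : 0 < w ϑ
  linear_le : L * δ ≤ w ϑ / 2

namespace IsLaplacePair

variable {D w : ℝ → ℝ} {ϑ α δ C L : ℝ}

theorem abs_phase_sub_le (h : IsLaplacePair D w ϑ α δ C L) {t : ℝ} (ht : t ∈ Metric.ball ϑ δ) :
    |D t - α * (t - ϑ) ^ 2| ≤ α / 2 * (t - ϑ) ^ 2 := by
  have h1 := h.phase t ht
  rw [Metric.mem_ball, Real.dist_eq] at ht
  have h2 : C * |t - ϑ| ^ 3 = C * |t - ϑ| * (t - ϑ) ^ 2 := by rw [← sq_abs (t - ϑ)]; ring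
  have h3 : C * |t - ϑ| ≤ α / 2 :=
    (mul_le_mul_of_nonneg_left ht.le h.cubic_nonneg).trans h.cubic_le
  rw [h2] at h1
  exact h1.trans (mul_le_mul_of_nonneg_right h3 (sq_nonneg _))

theorem abs_amplitude_sub_le (h : IsLaplacePair D w ϑ α δ C L) {t : ℝ}
    (ht : t ∈ Metric.ball ϑ δ) : |w t - w ϑ| ≤ w ϑ / 2 := by
  have h1 := h.amplitude t ht
  rw [Metric.mem_ball, Real.dist_eq] at ht
  exact h1.trans ((mul_le_mul_of_nonneg_left ht.le h.linear_nonneg).trans h.linear_le)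

/-- Amplitude and exponential are replaced one at a time. Both exponents are at least half the
quadratic, so a Gaussian of curvature `α / 2` dominates each difference. -/
theorem abs_sub_gaussian_le (h : IsLaplacePair D w ϑ α δ C L) {t ε : ℝ}
    (ht : t ∈ Metric.ball ϑ δ) (hε : 0 < ε) :
    |w t * Real.exp (-(D t) / (2 * ε)) - w ϑ * Real.exp (-(α * (t - ϑ) ^ 2) / (2 * ε))|
      ≤ (L * |t - ϑ| + w ϑ * C / (2 * ε) * |t - ϑ| ^ 3)
        * Real.exp (-(α / 2 * (t - ϑ) ^ 2) / (2 * ε)) := by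
  have hq := abs_le.1 (h.abs_phase_sub_le ht)
  have hα := h.curvature_pos
  have hsq := sq_nonneg (t - ϑ)
  have hw := h.amplitude_pos
  have h1 : α / 2 * (t - ϑ) ^ 2 / (2 * ε) ≤ D t / (2 * ε) := by gcongr; linarith
  have h2 : α / 2 * (t - ϑ) ^ 2 / (2 * ε) ≤ α * (t - ϑ) ^ 2 / (2 * ε) := by gcongr; linarith
  have h3 := abs_exp_neg_sub_exp_neg_le h1 h2
  have h4 : |D t / (2 * ε) - α * (t - ϑ) ^ 2 / (2 * ε)| ≤ C * |t - ϑ| ^ 3 / (2 * ε) := by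
    rw [← sub_div, abs_div, abs_of_pos (by positivity : 0 < 2 * ε)]
    gcongr
    exact h.phase t ht
  have h5 : Real.exp (-(D t / (2 * ε))) ≤ Real.exp (-(α / 2 * (t - ϑ) ^ 2 / (2 * ε))) :=
    Real.exp_le_exp.2 (by linarith)
  simp only [neg_div]
  set E := Real.exp (-(α / 2 * (t - ϑ) ^ 2 / (2 * ε)))
  have hE : 0 < E := Real.exp_pos _
  calc _ = |(w t - w ϑ) * Real.exp (-(D t / (2 * ε)))
        + w ϑ * (Real.exp (-(D t / (2 * ε))) - Real.exp (-(α * (t - ϑ) ^ 2 / (2 * ε))))| := by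
        congr 1; ring
    _ ≤ |w t - w ϑ| * Real.exp (-(D t / (2 * ε)))
        + w ϑ * |Real.exp (-(D t / (2 * ε))) - Real.exp (-(α * (t - ϑ) ^ 2 / (2 * ε)))| := by
        refine (abs_add_le _ _).trans_eq ?_
        rw [abs_mul, abs_mul, abs_of_pos hw, abs_of_pos (Real.exp_pos (-(D t / (2 * ε))))]
    _ ≤ L * |t - ϑ| * E + w ϑ * (C * |t - ϑ| ^ 3 / (2 * ε) * E) := by
        gcongr
        · have := h.linear_nonneg; positivity
        · exact h.amplitude t ht
        · exact h3.trans (mul_le_mul_of_nonneg_right h4 hE.le)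
    _ = _ := by ring

theorem abs_pow_mul_le (h : IsLaplacePair D w ϑ α δ C L) {t ε : ℝ} (ht : t ∈ Metric.ball ϑ δ)
    (hε : 0 < ε) (n : ℕ) :
    |(t - ϑ) ^ n * (w t * Real.exp (-(D t) / (2 * ε)))|
      ≤ 3 / 2 * w ϑ * (|t - ϑ| ^ n * Real.exp (-(α / 2 * (t - ϑ) ^ 2) / (2 * ε))) := by
  have hq := abs_le.1 (h.abs_phase_sub_le ht)
  have ha := abs_le.1 (h.abs_amplitude_sub_le ht)
  have hw := h.amplitude_pos
  have h0 : 0 < w t := by linarith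
  have h5 : Real.exp (-(D t) / (2 * ε)) ≤ Real.exp (-(α / 2 * (t - ϑ) ^ 2) / (2 * ε)) := by
    refine Real.exp_le_exp.2 ?_
    gcongr; linarith
  have h6 : w t ≤ 3 / 2 * w ϑ := by linarith
  rw [abs_mul, abs_pow, abs_mul, abs_of_pos h0, abs_of_pos (Real.exp_pos (-(D t) / (2 * ε)))]
  calc _ ≤ |t - ϑ| ^ n * (3 / 2 * w ϑ * Real.exp (-(α / 2 * (t - ϑ) ^ 2) / (2 * ε))) := by gcongr
    _ = _ := by ring

theorem continuousOn_pow_mul (h : IsLaplacePair D w ϑ α δ C L) (ε : ℝ) (n : ℕ) :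
    ContinuousOn (fun t => (t - ϑ) ^ n * (w t * Real.exp (-(D t) / (2 * ε))))
      (Metric.ball ϑ δ) := by
  have h1 := h.continuousOn_phase
  have h2 := h.continuousOn_amplitude
  fun_prop

theorem integrableOn_pow_mul (h : IsLaplacePair D w ϑ α δ C L) {ε : ℝ} (hε : 0 < ε) (n : ℕ) :
    IntegrableOn (fun t => (t - ϑ) ^ n * (w t * Real.exp (-(D t) / (2 * ε))))
      (Metric.ball ϑ δ) := by
  refine Integrable.mono' (((integrable_abs_sub_pow_mul_gaussian
    (half_pos h.curvature_pos) hε ϑ n).const_mul (3 / 2 * w ϑ)).integrableOn)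
    ((h.continuousOn_pow_mul ε n).aestronglyMeasurable measurableSet_ball) ?_
  filter_upwards [ae_restrict_mem measurableSet_ball] with t ht
  exact h.abs_pow_mul_le ht hε n

/-- The factor `√ε` is the mass of the unnormalized kernel. Natural division makes `(n + 1) / 2`
equal to `n / 2` for even `n`, where domination by a Gaussian suffices, and one half more for odd
`n`, where cancellation is needed. -/
theorem exists_abs_moment_le (h : IsLaplacePair D w ϑ α δ C L) (n : ℕ) :
    ∃ B : ℝ, ∀ ε : ℝ, 0 < ε →
      |∫ t in Metric.ball ϑ δ, (t - ϑ) ^ n * (w t * Real.exp (-(D t) / (2 * ε)))|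
        ≤ B * (√ε * ε ^ ((n + 1) / 2)) := by
  have hα2 := half_pos h.curvature_pos
  have hw := h.amplitude_pos
  rcases Nat.even_or_odd' n with ⟨k, rfl | rfl⟩
  · obtain ⟨G, hG, hGe⟩ := exists_integral_gaussian_eq (α / 2) ϑ (2 * k)
    refine ⟨3 / 2 * w ϑ * G, fun ε hε => ?_⟩
    have hint := (integrable_abs_sub_pow_mul_gaussian hα2 hε ϑ (2 * k)).const_mul (3 / 2 * w ϑ)
    have h1 := norm_integral_le_of_norm_le (hint.integrableOn (s := Metric.ball ϑ δ))
      (f := fun t => (t - ϑ) ^ (2 * k) * (w t * Real.exp (-(D t) / (2 * ε))))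
      ((ae_restrict_mem measurableSet_ball).mono fun t ht => h.abs_pow_mul_le ht hε (2 * k))
    have h2 := setIntegral_le_integral (s := Metric.ball ϑ δ) hint
      (Eventually.of_forall fun t => by simp only [Pi.zero_apply]; positivity)
    refine (h1.trans h2).trans_eq ?_
    rw [integral_const_mul, hGe ε hε]
    rw [show (2 * k + 1) / 2 = k by lia, pow_succ, pow_mul, Real.sq_sqrt hε.le]
    ring
  -- The amplitude error contributes one more power of `|t - ϑ|`, the phase error three more divided
  -- by `ε`; both gain a factor `√ε`.
  · obtain ⟨G₁, hG₁, hGe₁⟩ := exists_integral_gaussian_eq (α / 2) ϑ (2 * k + 1 + 1)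
    obtain ⟨G₂, hG₂, hGe₂⟩ := exists_integral_gaussian_eq (α / 2) ϑ (2 * k + 1 + 3)
    refine ⟨L * G₁ + w ϑ * C / 2 * G₂, fun ε hε => ?_⟩
    have hint₁ := (integrable_abs_sub_pow_mul_gaussian hα2 hε ϑ (2 * k + 1 + 1)).const_mul L
    have hint₂ := (integrable_abs_sub_pow_mul_gaussian hα2 hε ϑ (2 * k + 1 + 3)).const_mul
      (w ϑ * C / (2 * ε))
    have hint := hint₁.add hint₂
    have hG : IntegrableOn (fun t => (t - ϑ) ^ (2 * k + 1)
        * (w ϑ * Real.exp (-(α * (t - ϑ) ^ 2) / (2 * ε)))) (Metric.ball ϑ δ) := by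
      refine Integrable.integrableOn (Integrable.mono' ((integrable_abs_sub_pow_mul_gaussian
        h.curvature_pos hε ϑ (2 * k + 1)).const_mul (w ϑ)) (by fun_prop)
        (Eventually.of_forall fun t => le_of_eq ?_))
      rw [Real.norm_eq_abs, abs_mul, abs_pow, abs_mul, abs_of_pos hw, Real.abs_exp]
      ring
    have hG0 : ∫ t in Metric.ball ϑ δ, (t - ϑ) ^ (2 * k + 1)
        * (w ϑ * Real.exp (-(α * (t - ϑ) ^ 2) / (2 * ε))) = 0 :=
      setIntegral_ball_odd_eq_zero (g := fun s => s ^ (2 * k + 1)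
        * (w ϑ * Real.exp (-(α * s ^ 2) / (2 * ε))))
        (fun s => by simp only [neg_sq, Odd.neg_pow (⟨k, rfl⟩ : Odd (2 * k + 1))]; ring) ϑ δ
    rw [← sub_zero (∫ t in _, _), ← hG0, ← integral_sub (h.integrableOn_pow_mul hε _) hG]
    have h1 := norm_integral_le_of_norm_le (hint.integrableOn (s := Metric.ball ϑ δ))
      (f := fun t => (t - ϑ) ^ (2 * k + 1) * (w t * Real.exp (-(D t) / (2 * ε)))
        - (t - ϑ) ^ (2 * k + 1) * (w ϑ * Real.exp (-(α * (t - ϑ) ^ 2) / (2 * ε))))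
      ((ae_restrict_mem measurableSet_ball).mono fun t ht => by
        rw [← mul_sub, norm_mul, norm_pow, Real.norm_eq_abs, Real.norm_eq_abs]
        refine (mul_le_mul_of_nonneg_left (h.abs_sub_gaussian_le ht hε) (by positivity)).trans_eq ?_
        simp only [Pi.add_apply]
        ring)
    have h2 := setIntegral_le_integral (s := Metric.ball ϑ δ) hint
      (Eventually.of_forall fun t => by
        have := h.linear_nonneg
        have := h.cubic_nonneg
        simp only [Pi.zero_apply, Pi.add_apply]
        positivity)
    have h3 : ∫ t, (((fun t => L * (|t - ϑ| ^ (2 * k + 1 + 1)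
        * Real.exp (-(α / 2 * (t - ϑ) ^ 2) / (2 * ε)))) + fun t => w ϑ * C / (2 * ε)
        * (|t - ϑ| ^ (2 * k + 1 + 3) * Real.exp (-(α / 2 * (t - ϑ) ^ 2) / (2 * ε)))) : ℝ → ℝ) t
        = L * (G₁ * √ε ^ (2 * k + 1 + 1 + 1))
          + w ϑ * C / (2 * ε) * (G₂ * √ε ^ (2 * k + 1 + 3 + 1)) := by
      rw [integral_add' hint₁ hint₂, integral_const_mul, integral_const_mul, hGe₁ ε hε, hGe₂ ε hε]
    rw [h3] at h2
    refine (h1.trans h2).trans_eq ?_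
    rw [show (2 * k + 1 + 1) / 2 = k + 1 by lia,
      show 2 * k + 1 + 1 + 1 = 2 * (k + 1) + 1 by ring,
      show 2 * k + 1 + 3 + 1 = 2 * (k + 2) + 1 by ring, pow_succ, pow_succ, pow_mul, pow_mul,
      Real.sq_sqrt hε.le]
    field_simp
    ring

theorem exists_integral_ge (h : IsLaplacePair D w ϑ α δ C L) :
    ∃ b : ℝ, 0 < b ∧ ∀ ε : ℝ, 0 < ε → ε ≤ δ ^ 2 →
      b * √ε ≤ ∫ t in Metric.ball ϑ δ, w t * Real.exp (-(D t) / (2 * ε)) := by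
  have hw := h.amplitude_pos
  have hα := h.curvature_pos
  refine ⟨w ϑ * Real.exp (-(3 / 4 * α)), by positivity, fun ε hε hεδ => ?_⟩
  have hs : √ε ≤ δ := by
    rw [← Real.sqrt_sq h.radius_pos.le]; exact Real.sqrt_le_sqrt hεδ
  have hsub : Metric.ball ϑ √ε ⊆ Metric.ball ϑ δ := Metric.ball_subset_ball hs
  have hint := h.integrableOn_pow_mul hε 0
  simp only [pow_zero, one_mul] at hint
  have h1 : ∫ t in Metric.ball ϑ √ε, w t * Real.exp (-(D t) / (2 * ε))
      ≤ ∫ t in Metric.ball ϑ δ, w t * Real.exp (-(D t) / (2 * ε)) := by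
    refine setIntegral_mono_set hint ?_ (Eventually.of_forall hsub)
    filter_upwards [ae_restrict_mem measurableSet_ball] with t ht
    have ha := abs_le.1 (h.abs_amplitude_sub_le ht)
    exact mul_nonneg (by linarith) (Real.exp_pos _).le
  refine le_trans ?_ h1
  have h2 : ∫ t in Metric.ball ϑ √ε, w ϑ / 2 * Real.exp (-(3 / 4 * α))
      ≤ ∫ t in Metric.ball ϑ √ε, w t * Real.exp (-(D t) / (2 * ε)) := by
    refine setIntegral_mono_on (integrableOn_const measure_ball_lt_top.ne) (hint.mono_set hsub)
      measurableSet_ball fun t ht => ?_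
    have hq := abs_le.1 (h.abs_phase_sub_le (hsub ht))
    have ha := abs_le.1 (h.abs_amplitude_sub_le (hsub ht))
    rw [Metric.mem_ball, Real.dist_eq] at ht
    have hsq : (t - ϑ) ^ 2 ≤ ε := by
      rw [← sq_abs, ← Real.sq_sqrt hε.le]; gcongr
    -- On the ball of radius `√ε` the phase is at most `3/2 * α * ε`. The volume `2√ε` of that ball
    -- cancels the factor `1/2` lost in the amplitude.
    have : -(3 / 4 * α) ≤ -(D t) / (2 * ε) := by
      rw [neg_div, neg_le_neg_iff, div_le_iff₀ (by positivity)]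
      nlinarith
    have hw2 : w ϑ / 2 ≤ w t := by linarith
    have hw3 : 0 ≤ w t := by linarith
    gcongr
  refine le_trans (le_of_eq ?_) h2
  simp [Real.volume_real_ball]
  ring

end IsLaplacePair

/-! ### Dispersion models -/

theorem contDiffOn_deriv_fst {Θ : Set ℝ} (hΘ : IsOpen Θ) {G : ℝ × ℝ → ℝ} {n : ℕ}
    (hG : ContDiffOn ℝ (n + 1) G (Θ ×ˢ Θ)) :
    ContDiffOn ℝ n (fun p : ℝ × ℝ => deriv (fun s => G (s, p.2)) p.1) (Θ ×ˢ Θ) := by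
  have h1 : ContDiffOn ℝ n (fun p => fderiv ℝ G p (1, 0)) (Θ ×ˢ Θ) :=
    (hG.fderiv_of_isOpen (hΘ.prod hΘ) le_rfl).clm_apply contDiffOn_const
  refine h1.congr fun p hp => ?_
  have h2 : DifferentiableAt ℝ G (p.1, p.2) :=
    (hG.differentiableOn (by simp)).differentiableAt ((hΘ.prod hΘ).mem_nhds hp)
  have h3 : HasDerivAt (fun s => (s, p.2)) ((1 : ℝ), (0 : ℝ)) p.1 :=
    (hasDerivAt_id p.1).prodMk (hasDerivAt_const p.1 p.2)
  exact (h2.hasFDerivAt.comp_hasDerivAt p.1 h3).deriv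

theorem exists_abs_iteratedDeriv_le {Θ S : Set ℝ} (hΘ : IsOpen Θ) {F : ℝ → ℝ} {n : ℕ}
    (hF : ContDiffOn ℝ n F Θ) (hS : IsCompact S) (hSΘ : S ⊆ Θ) :
    ∃ K : ℝ, 0 ≤ K ∧ ∀ t ∈ S, |iteratedDeriv n F t| ≤ K := by
  have h1 : ContinuousOn (iteratedDeriv n F) Θ :=
    (hF.continuousOn_iteratedDerivWithin le_rfl hΘ.uniqueDiffOn).congr
      fun t ht => (iteratedDerivWithin_of_isOpen hΘ ht).symm
  obtain ⟨K, hK⟩ := hS.exists_bound_of_continuousOn (h1.mono hSΘ)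
  exact ⟨max K 0, le_max_right _ _, fun t ht => (hK t ht).trans (le_max_left _ _)⟩

namespace IsProperDispersionModel

variable {Θ : Set ℝ} {d : ℝ → ℝ → ℝ} {a : ℝ → ℝ} {ϑ : ℝ}

theorem unitVariance_pos (hQ : IsProperDispersionModel Θ d a) {t : ℝ} (ht : t ∈ Θ) :
    0 < unitVariance d t := mul_pos two_pos (inv_pos.2 (hQ.deriv_pos t ht))

theorem kernel_pos (hQ : IsProperDispersionModel Θ d a) (m ε : ℝ) {t : ℝ} (ht : t ∈ Θ) :
    0 < dispersionKernel d m ε t :=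
  mul_pos (Real.rpow_pos_of_pos (hQ.unitVariance_pos ht) _) (Real.exp_pos _)

theorem nonneg (hQ : IsProperDispersionModel Θ d a) {t m : ℝ} (ht : t ∈ Θ) (hm : m ∈ Θ) :
    0 ≤ d t m := by
  rcases eq_or_ne t m with rfl | h
  · exact (hQ.diag t ht).ge
  · exact (hQ.pos t ht m hm h).le

theorem contDiffOn_section {n : WithTop ℕ∞} (hd : ContDiffOn ℝ n (Function.uncurry d) (Θ ×ˢ Θ))
    (hϑ : ϑ ∈ Θ) : ContDiffOn ℝ n (fun t => d t ϑ) Θ :=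
  hd.comp (contDiffOn_id.prodMk contDiffOn_const) fun _ ht => ⟨ht, hϑ⟩

/-- The unit variance costs two derivatives of `d`: `C³` makes the amplitude `C¹`, which yields its
linear error bound, and `C²` makes it continuous. -/
theorem contDiffOn_amplitude (hΘ : IsOpen Θ) (hQ : IsProperDispersionModel Θ d a) {n : ℕ}
    (hd : ContDiffOn ℝ (n + 2 : ℕ) (Function.uncurry d) (Θ ×ˢ Θ)) :
    ContDiffOn ℝ n (fun t => unitVariance d t ^ (-1 / 2 : ℝ)) Θ := by
  have h1 := contDiffOn_deriv_fst (n := n) hΘ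
    (contDiffOn_deriv_fst (n := n + 1) hΘ (by exact_mod_cast hd))
  have h2 : ContDiffOn ℝ n (fun t => iteratedDeriv 2 (fun s => d s t) t) Θ := by
    refine (h1.comp (contDiffOn_id.prodMk contDiffOn_id) fun _ ht => ⟨ht, ht⟩).congr
      fun t ht => ?_
    rw [iteratedDeriv_succ, iteratedDeriv_one]
    rfl
  refine ContDiffOn.rpow_const_of_ne ?_ fun t ht => (hQ.unitVariance_pos ht).ne'
  exact contDiffOn_const.mul (h2.inv fun t ht => (hQ.deriv_pos t ht).ne')

theorem continuousOn_kernel (hΘ : IsOpen Θ) (hQ : IsProperDispersionModel Θ d a) (hϑ : ϑ ∈ Θ)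
    (ε : ℝ) : ContinuousOn (dispersionKernel d ϑ ε) Θ := by
  have h1 := (hQ.contDiffOn_amplitude hΘ (n := 0) (by exact_mod_cast hQ.contDiff)).continuousOn
  have h2 := (contDiffOn_section hQ.contDiff hϑ).continuousOn
  exact h1.mul (Real.continuous_exp.comp_continuousOn (h2.neg.div_const _))

theorem aemeasurable_density (hΘ : IsOpen Θ) (hQ : IsProperDispersionModel Θ d a) (hϑ : ϑ ∈ Θ)
    (ε : ℝ) : AEMeasurable (fun t => ENNReal.ofReal (a ε * dispersionKernel d ϑ ε t))
      (volume.restrict Θ) :=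
  ((hQ.continuousOn_kernel hΘ hϑ ε).aemeasurable hΘ.measurableSet).const_mul (a ε)
    |>.ennreal_ofReal

/-- For `a ε ≤ 0` the density is truncated to zero by `ENNReal.ofReal`, contradicting total mass
one. -/
theorem normalizer_pos (hΘ : IsOpen Θ) (hQ : IsProperDispersionModel Θ d a) (hϑ : ϑ ∈ Θ) {ε : ℝ}
    (hε : 0 < ε) : 0 < a ε := by
  by_contra h
  have h1 := (hQ.isProbability ϑ hϑ ε hε).measure_univ
  rw [dispersionLaw, withDensity_apply _ MeasurableSet.univ, Measure.restrict_univ,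
    setLIntegral_congr_fun hΘ.measurableSet (g := fun _ => 0) fun t ht =>
      ENNReal.ofReal_of_nonpos
        (mul_nonpos_of_nonpos_of_nonneg (not_lt.1 h) (hQ.kernel_pos ϑ ε ht).le)] at h1
  simp at h1

theorem setIntegral_law (hΘ : IsOpen Θ) (hQ : IsProperDispersionModel Θ d a) (hϑ : ϑ ∈ Θ) {ε : ℝ}
    (hε : 0 < ε) {S : Set ℝ} (hS : MeasurableSet S) (h : ℝ → ℝ) :
    ∫ t in S, h t ∂dispersionLaw Θ d a ϑ ε
      = a ε * ∫ t in S ∩ Θ, h t * dispersionKernel d ϑ ε t := by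
  rw [dispersionLaw, setIntegral_withDensity_eq_setIntegral_toReal_smul₀
    (hQ.aemeasurable_density hΘ hϑ ε).restrict (Eventually.of_forall fun _ => ENNReal.ofReal_lt_top)
    h hS, Measure.restrict_restrict hS, ← integral_const_mul]
  refine setIntegral_congr_fun (hS.inter hΘ.measurableSet) fun t ht => ?_
  have := mul_pos (hQ.normalizer_pos hΘ hϑ hε) (hQ.kernel_pos ϑ ε ht.2)
  simp only [smul_eq_mul, ENNReal.toReal_ofReal this.le]
  ring

theorem integral_law (hΘ : IsOpen Θ) (hQ : IsProperDispersionModel Θ d a) (hϑ : ϑ ∈ Θ) {ε : ℝ}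
    (hε : 0 < ε) (h : ℝ → ℝ) :
    ∫ t, h t ∂dispersionLaw Θ d a ϑ ε = a ε * ∫ t in Θ, h t * dispersionKernel d ϑ ε t := by
  simpa using hQ.setIntegral_law hΘ hϑ hε MeasurableSet.univ h

theorem integrable_law_iff (hΘ : IsOpen Θ) (hQ : IsProperDispersionModel Θ d a) (hϑ : ϑ ∈ Θ)
    {ε : ℝ} (hε : 0 < ε) (h : ℝ → ℝ) :
    Integrable h (dispersionLaw Θ d a ϑ ε)
      ↔ IntegrableOn (fun t => h t * dispersionKernel d ϑ ε t) Θ := by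
  have ha := hQ.normalizer_pos hΘ hϑ hε
  rw [dispersionLaw, integrable_withDensity_iff_integrable_smul₀'
    (hQ.aemeasurable_density hΘ hϑ ε) (Eventually.of_forall fun _ => ENNReal.ofReal_lt_top),
    IntegrableOn, ← integrable_const_mul_iff (IsUnit.mk0 _ ha.ne')
      fun t => h t * dispersionKernel d ϑ ε t]
  refine integrable_congr ?_
  filter_upwards [ae_restrict_mem hΘ.measurableSet] with t ht
  rw [ENNReal.toReal_ofReal (mul_pos ha (hQ.kernel_pos ϑ ε ht)).le, smul_eq_mul]
  ring

theorem integrableOn_kernel (hΘ : IsOpen Θ) (hQ : IsProperDispersionModel Θ d a) (hϑ : ϑ ∈ Θ)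
    {ε : ℝ} (hε : 0 < ε) : IntegrableOn (dispersionKernel d ϑ ε) Θ := by
  have := hQ.isProbability ϑ hϑ ε hε
  simpa using (hQ.integrable_law_iff hΘ hϑ hε fun _ => 1).1 (integrable_const _)

theorem normalizer_mul_integral (hΘ : IsOpen Θ) (hQ : IsProperDispersionModel Θ d a)
    (hϑ : ϑ ∈ Θ) {ε : ℝ} (hε : 0 < ε) : a ε * ∫ t in Θ, dispersionKernel d ϑ ε t = 1 := by
  have := hQ.isProbability ϑ hϑ ε hε
  simpa using (hQ.integral_law hΘ hϑ hε fun _ => 1).symm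

theorem mixture_eq_div (hΘ : IsOpen Θ) (hQ : IsProperDispersionModel Θ d a) (hϑ : ϑ ∈ Θ) {ε : ℝ}
    (hε : 0 < ε) {X : Type*} (f : X → ℝ → ℝ) (x : X) :
    mixture f (dispersionLaw Θ d a ϑ ε) x =
      (∫ t in Θ, f x t * dispersionKernel d ϑ ε t) / ∫ t in Θ, dispersionKernel d ϑ ε t := by
  have h1 := hQ.normalizer_mul_integral hΘ hϑ hε
  rw [mixture, hQ.integral_law hΘ hϑ hε, eq_div_iff (right_ne_zero_of_mul_eq_one h1),
    mul_right_comm, h1, one_mul]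

theorem exists_isLaplacePair (hΘ : IsOpen Θ) (hQ : IsProperDispersionModel Θ d a)
    (hd : ContDiffOn ℝ 3 (Function.uncurry d) (Θ ×ˢ Θ)) (hϑ : ϑ ∈ Θ) :
    ∃ α δ C L : ℝ, Metric.closedBall ϑ δ ⊆ Θ ∧
      IsLaplacePair (fun t => d t ϑ) (fun t => unitVariance d t ^ (-1 / 2 : ℝ)) ϑ α δ C L := by
  obtain ⟨δ₀, hδ₀, hball⟩ := Metric.nhds_basis_closedBall.mem_iff.1 (hΘ.mem_nhds hϑ)
  have hD : ContDiffOn ℝ (3 : ℕ) (fun t => d t ϑ) Θ := contDiffOn_section hd hϑ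
  have hw : ContDiffOn ℝ (1 : ℕ) (fun t => unitVariance d t ^ (-1 / 2 : ℝ)) Θ :=
    hQ.contDiffOn_amplitude hΘ (by exact_mod_cast hd)
  obtain ⟨C, hC, hCb⟩ := exists_abs_iteratedDeriv_le hΘ hD (isCompact_closedBall ϑ δ₀) hball
  obtain ⟨L, hL, hLb⟩ := exists_abs_iteratedDeriv_le hΘ hw (isCompact_closedBall ϑ δ₀) hball
  have hbc : Metric.ball ϑ δ₀ ⊆ Metric.closedBall ϑ δ₀ := Metric.ball_subset_closedBall
  have hmin : iteratedDeriv 1 (fun t => d t ϑ) ϑ = 0 := by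
    rw [iteratedDeriv_one]
    refine IsLocalMin.deriv_eq_zero ?_
    filter_upwards [hΘ.mem_nhds hϑ] with t ht
    rw [hQ.diag ϑ hϑ]
    exact hQ.nonneg ht hϑ
  have hα := half_pos (hQ.deriv_pos ϑ hϑ)
  set α := iteratedDeriv 2 (fun s => d s ϑ) ϑ / 2 with hαdef
  have hw0 : 0 < unitVariance d ϑ ^ (-1 / 2 : ℝ) :=
    Real.rpow_pos_of_pos (hQ.unitVariance_pos hϑ) _
  -- The radius is small enough for the cubic and the linear errors to stay below half their leading
  -- terms; `C + 1` and `L + 1` avoid division by zero.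
  set δ := min δ₀ (min (α / 2 / (C + 1)) (unitVariance d ϑ ^ (-1 / 2 : ℝ) / 2 / (L + 1))) with hδ
  have hδ1 : δ ≤ δ₀ := min_le_left _ _
  have hδ2 : δ ≤ α / 2 / (C + 1) := (min_le_right _ _).trans (min_le_left _ _)
  have hδ3 : δ ≤ unitVariance d ϑ ^ (-1 / 2 : ℝ) / 2 / (L + 1) :=
    (min_le_right _ _).trans (min_le_right _ _)
  have hδ0 : 0 < δ := by positivity
  have hsub : Metric.ball ϑ δ ⊆ Metric.ball ϑ δ₀ := Metric.ball_subset_ball hδ1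
  rw [le_div_iff₀ (by positivity)] at hδ2 hδ3
  refine ⟨α, δ, C, L, (Metric.closedBall_subset_closedBall hδ1).trans hball, hα, hδ0,
    hD.continuousOn.mono ((hsub.trans hbc).trans hball),
    hw.continuousOn.mono ((hsub.trans hbc).trans hball), fun t ht => ?_, hC, by linarith,
    fun t ht => ?_, hL, hw0, by linarith⟩
  · have h := abs_sub_taylor_le Metric.isOpen_ball (convex_ball ϑ δ₀)
      (Metric.mem_ball_self hδ₀) 3 (hD.mono (hbc.trans hball)) (fun s hs => hCb s (hbc hs))
      (hsub ht)
    simpa [Finset.sum_range_succ, hmin, hQ.diag ϑ hϑ, hαdef] using h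
  · have h := abs_sub_taylor_le Metric.isOpen_ball (convex_ball ϑ δ₀)
      (Metric.mem_ball_self hδ₀) 1 (hw.mono (hbc.trans hball)) (fun s hs => hLb s (hbc hs))
      (hsub ht)
    simpa using h

/-- `a ε` is the reciprocal of the kernel's integral, which Laplace's lower bound on the ball keeps
above a multiple of `√ε`. -/
theorem exists_normalizer_le (hΘ : IsOpen Θ) (hQ : IsProperDispersionModel Θ d a) (hϑ : ϑ ∈ Θ)
    {α δ C L : ℝ} (hδ : Metric.ball ϑ δ ⊆ Θ)
    (h : IsLaplacePair (fun t => d t ϑ) (fun t => unitVariance d t ^ (-1 / 2 : ℝ)) ϑ α δ C L) :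
    ∃ b : ℝ, 0 < b ∧ ∀ᶠ ε in 𝓝[>] 0, a ε * √ε ≤ b := by
  obtain ⟨b, hb, hbε⟩ := h.exists_integral_ge
  refine ⟨b⁻¹, inv_pos.2 hb, ?_⟩
  filter_upwards [Ioc_mem_nhdsGT (pow_pos h.radius_pos 2)] with ε hε
  have h1 := hbε ε hε.1 hε.2
  have h2 : ∫ t in Metric.ball ϑ δ, dispersionKernel d ϑ ε t
      ≤ ∫ t in Θ, dispersionKernel d ϑ ε t := by
    refine setIntegral_mono_set (hQ.integrableOn_kernel hΘ hϑ hε.1) ?_ (Eventually.of_forall hδ)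
    filter_upwards [ae_restrict_mem hΘ.measurableSet] with t ht
    exact (hQ.kernel_pos ϑ ε ht).le
  have ha := hQ.normalizer_pos hΘ hϑ hε.1
  have h3 := hQ.normalizer_mul_integral hΘ hϑ hε.1
  have h4 := mul_le_mul_of_nonneg_left (h1.trans h2) ha.le
  rw [h3] at h4
  rw [← one_div, le_div_iff₀ hb]
  linarith

theorem isBigO_setIntegral_ball (hΘ : IsOpen Θ) (hQ : IsProperDispersionModel Θ d a) (hϑ : ϑ ∈ Θ)
    {α δ C L : ℝ} (hδ : Metric.ball ϑ δ ⊆ Θ)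
    (h : IsLaplacePair (fun t => d t ϑ) (fun t => unitVariance d t ^ (-1 / 2 : ℝ)) ϑ α δ C L)
    (n : ℕ) :
    (fun ε => ∫ t in Metric.ball ϑ δ, (t - ϑ) ^ n ∂dispersionLaw Θ d a ϑ ε)
      =O[𝓝[>] 0] fun ε => ε ^ ((n + 1) / 2) := by
  obtain ⟨b, hb, hbε⟩ := hQ.exists_normalizer_le hΘ hϑ hδ h
  obtain ⟨B, hB⟩ := h.exists_abs_moment_le n
  refine IsBigO.of_bound (b * |B|) ?_
  filter_upwards [hbε, self_mem_nhdsWithin] with ε hε hε0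
  rw [Set.mem_Ioi] at hε0
  have ha := hQ.normalizer_pos hΘ hϑ hε0
  rw [hQ.setIntegral_law hΘ hϑ hε0 measurableSet_ball, Set.inter_eq_left.2 hδ, norm_mul,
    Real.norm_of_nonneg ha.le, Real.norm_of_nonneg (by positivity : 0 ≤ ε ^ ((n + 1) / 2))]
  calc _ ≤ a ε * (|B| * (√ε * ε ^ ((n + 1) / 2))) := by
        gcongr
        exact (hB ε hε0).trans (by gcongr; exact le_abs_self B)
    _ = a ε * √ε * (|B| * ε ^ ((n + 1) / 2)) := by ring
    _ ≤ b * (|B| * ε ^ ((n + 1) / 2)) := by gcongr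
    _ = _ := by ring

/-- The ratio of the kernels is `exp (-(d t ϑ) * (1 / (2ε) - 1 / (2ε₀)))`, which decreases in the
deviance. The case `c = 0` transfers integrability to smaller dispersions, and `c > 0` gives the
tails. -/
theorem kernel_le_kernel (hQ : IsProperDispersionModel Θ d a) {t ε ε₀ c : ℝ} (ht : t ∈ Θ)
    (hc : c ≤ d t ϑ) (hε : 0 < ε) (hεε : ε ≤ ε₀) :
    dispersionKernel d ϑ ε t
      ≤ Real.exp (c / (2 * ε₀)) * Real.exp (-(c / (2 * ε))) * dispersionKernel d ϑ ε₀ t := by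
  have hV := Real.rpow_pos_of_pos (hQ.unitVariance_pos ht) (-1 / 2 : ℝ)
  rw [dispersionKernel, dispersionKernel, mul_left_comm, ← Real.exp_add, ← Real.exp_add]
  refine mul_le_mul_of_nonneg_left (Real.exp_le_exp.2 ?_) hV.le
  have h1 : 1 / (2 * ε₀) ≤ 1 / (2 * ε) := by gcongr
  have h2 := mul_le_mul_of_nonneg_right hc (sub_nonneg.2 h1)
  have e : ∀ x y : ℝ, x / y = x * (1 / y) := fun x y => by ring
  rw [e (-d t ϑ) (2 * ε), e (-d t ϑ) (2 * ε₀), e c (2 * ε₀), e c (2 * ε)]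
  linarith

theorem integrable_law_of_le (hΘ : IsOpen Θ) (hQ : IsProperDispersionModel Θ d a) (hϑ : ϑ ∈ Θ)
    {h : ℝ → ℝ} {ε ε₀ : ℝ} (hint : Integrable h (dispersionLaw Θ d a ϑ ε₀)) (hε : 0 < ε)
    (hεε : ε ≤ ε₀) : Integrable h (dispersionLaw Θ d a ϑ ε) := by
  have hε₀ := hε.trans_le hεε
  rw [hQ.integrable_law_iff hΘ hϑ hε]
  rw [hQ.integrable_law_iff hΘ hϑ hε₀] at hint
  -- No measurability of `h` itself is assumed; it is recovered for the new product by multiplying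
  -- the old one with the continuous quotient of the kernels.
  have hm := hint.aestronglyMeasurable.mul
    (((hQ.continuousOn_kernel hΘ hϑ ε).div (hQ.continuousOn_kernel hΘ hϑ ε₀)
      fun t ht => (hQ.kernel_pos ϑ ε₀ ht).ne').aestronglyMeasurable hΘ.measurableSet)
  refine Integrable.mono hint (hm.congr ?_) ?_
  · filter_upwards [ae_restrict_mem hΘ.measurableSet] with t ht
    have := (hQ.kernel_pos ϑ ε₀ ht).ne'
    simp only [Pi.mul_apply, Pi.div_apply]
    field_simp
  · filter_upwards [ae_restrict_mem hΘ.measurableSet] with t ht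
    have h1 := hQ.kernel_le_kernel ht (hQ.nonneg ht hϑ) hε hεε
    simp only [zero_div, neg_zero, Real.exp_zero, one_mul] at h1
    rw [norm_mul, norm_mul, Real.norm_of_nonneg (hQ.kernel_pos ϑ ε ht).le,
      Real.norm_of_nonneg (hQ.kernel_pos ϑ ε₀ ht).le]
    gcongr

theorem isBigO_setIntegral_compl_ball (hΘ : IsOpen Θ) (hQ : IsProperDispersionModel Θ d a)
    (hϑ : ϑ ∈ Θ) {α δ C L : ℝ} (hδ : Metric.ball ϑ δ ⊆ Θ)
    (hL : IsLaplacePair (fun t => d t ϑ) (fun t => unitVariance d t ^ (-1 / 2 : ℝ)) ϑ α δ C L)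
    (htail : ∃ c > 0, ∀ t ∈ Θ, δ ≤ |t - ϑ| → c ≤ d t ϑ) {h : ℝ → ℝ} {ε₀ : ℝ} (hε₀ : 0 < ε₀)
    (hint : Integrable h (dispersionLaw Θ d a ϑ ε₀)) (n : ℕ) :
    (fun ε => ∫ t in (Metric.ball ϑ δ)ᶜ, |h t| ∂dispersionLaw Θ d a ϑ ε)
      =O[𝓝[>] 0] fun ε => ε ^ n := by
  obtain ⟨b, hb, hbε⟩ := hQ.exists_normalizer_le hΘ hϑ hδ hL
  obtain ⟨c, hc, hcd⟩ := htail
  have hint₀ := (hQ.integrable_law_iff hΘ hϑ hε₀ _).1 hint.abs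
  set I := ∫ t in Θ, |h t| * dispersionKernel d ϑ ε₀ t with hI
  have hI0 : 0 ≤ I := setIntegral_nonneg hΘ.measurableSet fun t ht =>
    mul_nonneg (abs_nonneg _) (hQ.kernel_pos ϑ ε₀ ht).le
  refine IsBigO.of_bound
    (b * (Real.exp (c / (2 * ε₀)) * ((n + 1).factorial * (2 / c) ^ (n + 1)) * I)) ?_
  filter_upwards [hbε, Ioc_mem_nhdsGT hε₀, Ioc_mem_nhdsGT one_pos] with ε hεb ⟨hε, hεε⟩ ⟨_, hε1⟩
  have ha := hQ.normalizer_pos hΘ hϑ hε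
  have hS : MeasurableSet ((Metric.ball ϑ δ)ᶜ ∩ Θ) :=
    measurableSet_ball.compl.inter hΘ.measurableSet
  set E := Real.exp (c / (2 * ε₀)) * Real.exp (-(c / (2 * ε))) with hE
  have h1 : ∫ t in (Metric.ball ϑ δ)ᶜ ∩ Θ, |h t| * dispersionKernel d ϑ ε t ≤ E * I := by
    calc _ ≤ ∫ t in (Metric.ball ϑ δ)ᶜ ∩ Θ, E * (|h t| * dispersionKernel d ϑ ε₀ t) := by
          refine setIntegral_mono_on (((hQ.integrable_law_iff hΘ hϑ hε _).1
            (hQ.integrable_law_of_le hΘ hϑ hint.abs hε hεε)).mono_set Set.inter_subset_right)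
            ((hint₀.mono_set Set.inter_subset_right).const_mul _) hS fun t ht => ?_
          have := hQ.kernel_le_kernel ht.2
            (hcd t ht.2 (by simpa [Real.dist_eq] using ht.1)) hε hεε
          rw [mul_left_comm]
          gcongr
      _ = E * ∫ t in (Metric.ball ϑ δ)ᶜ ∩ Θ, |h t| * dispersionKernel d ϑ ε₀ t :=
          integral_const_mul _ _
      _ ≤ E * I := by
          refine mul_le_mul_of_nonneg_left ?_ (by positivity)
          refine setIntegral_mono_set hint₀ ?_ (Eventually.of_forall Set.inter_subset_right)
          filter_upwards [ae_restrict_mem hΘ.measurableSet] with t ht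
          exact mul_nonneg (abs_nonneg _) (hQ.kernel_pos ϑ ε₀ ht).le
  -- One power more than `n`: the spare `ε ≤ √ε` absorbs the growth of `a ε`.
  have h2 : Real.exp (-(c / (2 * ε))) ≤ (n + 1).factorial * (2 / c) ^ (n + 1) * ε ^ (n + 1) := by
    have h3 := Real.pow_div_factorial_le_exp (c / (2 * ε)) (by positivity) (n + 1)
    rw [Real.exp_neg]
    refine (inv_anti₀ (by positivity) h3).trans_eq ?_
    rw [inv_div, div_pow, div_pow, mul_pow]
    field_simp
  have h4 : ε ≤ √ε := by
    rw [Real.le_sqrt hε.le hε.le]; nlinarith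
  rw [hQ.setIntegral_law hΘ hϑ hε measurableSet_ball.compl, norm_mul, Real.norm_of_nonneg ha.le,
    Real.norm_of_nonneg (by positivity : 0 ≤ ε ^ n), Real.norm_of_nonneg
      (setIntegral_nonneg hS fun t ht =>
        mul_nonneg (abs_nonneg _) (hQ.kernel_pos ϑ ε ht.2).le)]
  calc _ ≤ a ε * (Real.exp (c / (2 * ε₀))
        * ((n + 1).factorial * (2 / c) ^ (n + 1) * ε ^ (n + 1)) * I) := by
        gcongr
        exact h1.trans (by rw [hE]; gcongr)
    _ = a ε * ε * (Real.exp (c / (2 * ε₀)) * ((n + 1).factorial * (2 / c) ^ (n + 1)) * I)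
        * ε ^ n := by ring
    _ ≤ _ := by
        gcongr
        exact (mul_le_mul_of_nonneg_left h4 ha.le).trans hεb

end IsProperDispersionModel

/-! ### Moments and expansions of families of laws concentrating at a point -/

theorem integrableOn_ball_sub_pow (Q : Measure ℝ) [IsFiniteMeasure Q] (ϑ δ c : ℝ) (n : ℕ) :
    IntegrableOn (fun t : ℝ => (t - c) ^ n) (Metric.ball ϑ δ) Q :=
  ((by fun_prop : Continuous fun t : ℝ => (t - c) ^ n).continuousOn.integrableOn_compact
    (isCompact_closedBall ϑ δ)).mono_set Metric.ball_subset_closedBall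

/-- The term of degree `N + 1` is kept as a signed integral over the ball, so that odd cancellation
survives; an absolute value inside would lose a factor `√ε`. Since `N + 2` is even, the remainder
needs no such care. -/
theorem abs_integral_sub_taylor_le {Q : Measure ℝ} [IsProbabilityMeasure Q] {ϑ δ c K : ℝ}
    (hc : c ∈ Metric.ball ϑ δ) {N : ℕ} (hN : Even N) {F : ℝ → ℝ}
    (hF : ContDiffOn ℝ (N + 2 : ℕ) F (Metric.ball ϑ δ)) (hint : Integrable F Q)
    (hpow : ∀ i ≤ N, Integrable (fun t => (t - c) ^ i) Q)
    (hK : ∀ i ≤ N + 2, ∀ t ∈ Metric.ball ϑ δ, |iteratedDeriv i F t| ≤ K) :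
    |∫ t, F t ∂Q - ∑ i ∈ Finset.range (N + 1), scaledMoment Q c i * iteratedDeriv i F c|
      ≤ K * (|∫ t in Metric.ball ϑ δ, (t - c) ^ (N + 1) ∂Q|
          + |∫ t in Metric.ball ϑ δ, (t - c) ^ (N + 2) ∂Q|
          + ∑ i ∈ Finset.range (N + 1), ∫ t in (Metric.ball ϑ δ)ᶜ, |(t - c) ^ i| ∂Q)
        + ∫ t in (Metric.ball ϑ δ)ᶜ, |F t| ∂Q := by
  set k : ℕ → ℝ := fun i => iteratedDeriv i F c / (i.factorial : ℝ) with hk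
  have hK0 : 0 ≤ K := (abs_nonneg _).trans (hK 0 (by lia) c hc)
  have hkK : ∀ i ≤ N + 2, |k i| ≤ K := fun i hi => by
    rw [hk]
    simp only [abs_div, Nat.abs_cast]
    exact (div_le_self (abs_nonneg _) 
      (Nat.one_le_cast.2 i.factorial_pos)).trans (hK i hi c hc)
  set P : ℝ → ℝ := fun t => ∑ i ∈ Finset.range (N + 1), k i * (t - c) ^ i with hP
  have hPi : ∀ i ∈ Finset.range (N + 1), Integrable (fun t => k i * (t - c) ^ i) Q :=
    fun i hi => (hpow i (by simpa [Nat.lt_succ_iff] using hi)).const_mul _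
  have hPint : Integrable P Q := integrable_finsetSum _ hPi
  have hsub : Integrable (fun t => F t - P t) Q := hint.sub hPint
  have h1 : ∑ i ∈ Finset.range (N + 1), scaledMoment Q c i * iteratedDeriv i F c
      = ∫ t, P t ∂Q := by
    rw [hP, integral_finsetSum _ hPi]
    refine Finset.sum_congr rfl fun i _ => ?_
    rw [integral_const_mul, scaledMoment, hk]
    ring
  have hint1 := integrableOn_ball_sub_pow Q ϑ δ c (N + 1)
  have hint2 := integrableOn_ball_sub_pow Q ϑ δ c (N + 2)
  have hball : |∫ t in Metric.ball ϑ δ, (F t - P t) ∂Q|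
      ≤ K * |∫ t in Metric.ball ϑ δ, (t - c) ^ (N + 1) ∂Q|
        + K * |∫ t in Metric.ball ϑ δ, (t - c) ^ (N + 2) ∂Q| := by
    have e : ∫ t in Metric.ball ϑ δ, (F t - P t) ∂Q
        = k (N + 1) * ∫ t in Metric.ball ϑ δ, (t - c) ^ (N + 1) ∂Q
          + ∫ t in Metric.ball ϑ δ, (F t - P t - k (N + 1) * (t - c) ^ (N + 1)) ∂Q := by
      rw [integral_sub hsub.integrableOn (hint1.const_mul _), integral_const_mul]
      ring
    rw [e]
    refine (abs_add_le _ _).trans (add_le_add ?_ ?_)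
    · rw [abs_mul]
      exact mul_le_mul_of_nonneg_right (hkK _ (by lia)) (abs_nonneg _)
    · have h2 := norm_integral_le_of_norm_le (μ := Q.restrict (Metric.ball ϑ δ))
        (f := fun t => F t - P t - k (N + 1) * (t - c) ^ (N + 1)) (hint2.const_mul K)
        ((ae_restrict_mem measurableSet_ball).mono fun t ht => by
          have h3 := abs_sub_taylor_le Metric.isOpen_ball (convex_ball ϑ δ) hc (N + 2) hF
            (hK _ le_rfl) ht
          rw [Finset.sum_range_succ, ← sub_sub, Even.pow_abs (hN.add even_two)] at h3
          exact h3)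
      rw [integral_const_mul] at h2
      exact h2.trans (mul_le_mul_of_nonneg_left (le_abs_self _) hK0)
  have hcompl : |∫ t in (Metric.ball ϑ δ)ᶜ, (F t - P t) ∂Q|
      ≤ K * ∑ i ∈ Finset.range (N + 1), ∫ t in (Metric.ball ϑ δ)ᶜ, |(t - c) ^ i| ∂Q
        + ∫ t in (Metric.ball ϑ δ)ᶜ, |F t| ∂Q := by
    rw [integral_sub hint.integrableOn hPint.integrableOn, add_comm (K * _)]
    refine (abs_sub _ _).trans (add_le_add abs_integral_le_integral_abs ?_)
    rw [hP, integral_finsetSum _ fun i hi => (hPi i hi).integrableOn, Finset.mul_sum]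
    refine (Finset.abs_sum_le_sum_abs _ _).trans (Finset.sum_le_sum fun i hi => ?_)
    rw [integral_const_mul, abs_mul]
    exact mul_le_mul (hkK i (by rw [Finset.mem_range] at hi; lia)) abs_integral_le_integral_abs
      (abs_nonneg _) hK0
  rw [h1, ← integral_sub hint hPint,
    ← integral_add_compl measurableSet_ball hsub]
  refine (abs_add_le _ _).trans ((add_le_add hball hcompl).trans_eq ?_)
  ring

/-- As `ε → 0`, the probability measures `Q ε` concentrate at `ϑ` at rate `√ε`: the moments over a
ball around `ϑ` have the orders of those of a Gaussian law with variance `ε`, up to an asymmetry of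
relative size `√ε`, and integrals over its complement decrease faster than all powers. -/
structure IsConcentrating (Q : ℝ → Measure ℝ) (ϑ δ : ℝ) : Prop where
  radius_pos : 0 < δ
  isProbability : ∀ ε > 0, IsProbabilityMeasure (Q ε)
  moment : ∀ n : ℕ, (fun ε => ∫ t in Metric.ball ϑ δ, (t - ϑ) ^ n ∂Q ε)
    =O[𝓝[>] 0] fun ε : ℝ => ε ^ ((n + 1) / 2)
  integrable : ∀ (h : ℝ → ℝ) (ε₀ : ℝ), Integrable h (Q ε₀) →
    ∀ ε : ℝ, 0 < ε → ε ≤ ε₀ → Integrable h (Q ε)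
  tail : ∀ (h : ℝ → ℝ) (ε₀ : ℝ), 0 < ε₀ → Integrable h (Q ε₀) → ∀ n : ℕ,
    (fun ε => ∫ t in (Metric.ball ϑ δ)ᶜ, |h t| ∂Q ε) =O[𝓝[>] 0] fun ε : ℝ => ε ^ n

theorem isBigO_pow_of_le {m n : ℕ} (h : m ≤ n) :
    (fun ε : ℝ => ε ^ n) =O[𝓝[>] 0] fun ε : ℝ => ε ^ m :=
  IsBigO.of_bound' (by
    filter_upwards [Ioc_mem_nhdsGT one_pos] with ε hε
    rw [norm_pow, norm_pow, Real.norm_of_nonneg hε.1.le]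
    exact pow_le_pow_of_le_one hε.1.le hε.2 h)

namespace IsConcentrating

variable {Q : ℝ → Measure ℝ} {ϑ δ : ℝ} {c : ℝ → ℝ}

theorem eventually_abs_sub_le (hc : (fun ε => c ε - ϑ) =O[𝓝[>] 0] fun ε : ℝ => ε) {η : ℝ}
    (hη : 0 < η) : ∀ᶠ ε in 𝓝[>] 0, |c ε - ϑ| < η := by
  have h1 : Tendsto (fun ε => c ε - ϑ) (𝓝[>] 0) (𝓝 0) :=
    hc.trans_tendsto (tendsto_id.mono_left nhdsWithin_le_nhds)
  simpa [Real.dist_eq] using h1.eventually (Metric.ball_mem_nhds 0 hη)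

/-- Expand `(t - ϑ) + (ϑ - c ε)` binomially: each power traded for a shift of order `ε` gains at
least what it loses, as `(j + 1) / 2 + (n - j) ≥ (n + 1) / 2`. -/
theorem isBigO_ball_moment (hQ : IsConcentrating Q ϑ δ)
    (hc : (fun ε => c ε - ϑ) =O[𝓝[>] 0] fun ε : ℝ => ε) (n : ℕ) :
    (fun ε => ∫ t in Metric.ball ϑ δ, (t - c ε) ^ n ∂Q ε)
      =O[𝓝[>] 0] fun ε : ℝ => ε ^ ((n + 1) / 2) := by
  have hc' : (fun ε => ϑ - c ε) =O[𝓝[>] 0] fun ε : ℝ => ε := by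
    simpa using hc.neg_left
  have h1 : (fun ε => ∑ j ∈ Finset.range (n + 1), (∫ t in Metric.ball ϑ δ, (t - ϑ) ^ j ∂Q ε)
      * (ϑ - c ε) ^ (n - j) * (n.choose j : ℝ)) =O[𝓝[>] 0] fun ε : ℝ => ε ^ ((n + 1) / 2) := by
    refine IsBigO.fun_sum fun j hj => ?_
    rw [Finset.mem_range] at hj
    have h2 := ((hQ.moment j).mul (hc'.pow (n - j))).trans
      (g := fun ε : ℝ => ε ^ ((j + 1) / 2) * ε ^ (n - j)) (isBigO_refl _ _)
    simp_rw [← pow_add] at h2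
    simpa [mul_comm] using (h2.trans (isBigO_pow_of_le (by lia))).const_mul_left (n.choose j : ℝ)
  refine h1.congr' ?_ EventuallyEq.rfl
  filter_upwards [self_mem_nhdsWithin] with ε hε
  have := hQ.isProbability ε hε
  have h3 : ∀ t, (t - c ε) ^ n = ∑ j ∈ Finset.range (n + 1),
      (t - ϑ) ^ j * ((ϑ - c ε) ^ (n - j) * (n.choose j : ℝ)) := fun t => by
    rw [show t - c ε = (t - ϑ) + (ϑ - c ε) by ring, add_pow]
    exact Finset.sum_congr rfl fun _ _ => by ring
  simp_rw [h3]
  rw [integral_finsetSum _ fun j _ => (integrableOn_ball_sub_pow (Q ε) ϑ δ ϑ j).mul_const _]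
  refine Finset.sum_congr rfl fun j _ => ?_
  rw [integral_mul_const]; ring

/-- A fixed function dominating all `(t - c ε) ^ i` with `i ≤ 2 * r`: the tail estimate applies to
one integrand, whereas the centre moves with `ε`. -/
theorem integrable_one_add_abs_pow {P : Measure ℝ} [IsProbabilityMeasure P] (ϑ : ℝ) {r : ℕ}
    (h : Integrable (fun t : ℝ => t ^ (2 * r)) P) :
    Integrable (fun t : ℝ => (1 + |t - ϑ|) ^ (2 * r)) P := by
  refine Integrable.mono' (((integrable_const ((1 + |ϑ|) ^ (2 * r))).add h).const_mul
    (2 ^ (2 * r - 1))) (by fun_prop) (Eventually.of_forall fun t => ?_)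
  rw [Real.norm_of_nonneg (by positivity)]
  have h1 : 1 + |t - ϑ| ≤ (1 + |ϑ|) + |t| := by linarith [abs_sub t ϑ]
  refine (pow_le_pow_left₀ (by positivity) h1 _).trans
    ((add_pow_le (by positivity) (abs_nonneg t) (2 * r)).trans_eq ?_)
  rw [(even_two_mul r).pow_abs]
  rfl

theorem abs_sub_pow_le {c t : ℝ} {i N : ℕ} (hc : |c - ϑ| < 1) (hi : i ≤ N) :
    |(t - c) ^ i| ≤ (1 + |t - ϑ|) ^ N := by
  have h1 : |t - c| ≤ 1 + |t - ϑ| := by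
    have := abs_sub_le t ϑ c
    rw [abs_sub_comm ϑ c] at this
    linarith
  rw [abs_pow]
  exact (pow_le_pow_left₀ (abs_nonneg _) h1 i).trans
    (pow_le_pow_right₀ (by linarith [abs_nonneg (t - ϑ)]) hi)

/-! ### Full moments and expansions under a finite moment of order `2r` -/

section Moments

variable {r : ℕ} {ε₀ : ℝ}

theorem eventually_integrable (hQ : IsConcentrating Q ϑ δ) (hε₀ : 0 < ε₀) {h : ℝ → ℝ}
    (hint : Integrable h (Q ε₀)) : ∀ᶠ ε in 𝓝[>] 0, Integrable h (Q ε) := by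
  filter_upwards [Ioc_mem_nhdsGT hε₀] with ε hε
  exact hQ.integrable h ε₀ hint ε hε.1 hε.2

theorem eventually_integrable_sub_pow (hQ : IsConcentrating Q ϑ δ) (hε₀ : 0 < ε₀)
    (hmom : Integrable (fun t : ℝ => t ^ (2 * r)) (Q ε₀))
    (hc : (fun ε => c ε - ϑ) =O[𝓝[>] 0] fun ε : ℝ => ε) :
    ∀ᶠ ε in 𝓝[>] 0, ∀ i ≤ 2 * r, Integrable (fun t => (t - c ε) ^ i) (Q ε) := by
  have := hQ.isProbability ε₀ hε₀
  filter_upwards [hQ.eventually_integrable hε₀ (integrable_one_add_abs_pow ϑ hmom),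
    eventually_abs_sub_le hc one_pos] with ε h1 h2 i hi
  exact h1.mono' (by fun_prop) (Eventually.of_forall fun t => abs_sub_pow_le h2 hi)

theorem isBigO_tail_sub_pow (hQ : IsConcentrating Q ϑ δ) (hε₀ : 0 < ε₀)
    (hmom : Integrable (fun t : ℝ => t ^ (2 * r)) (Q ε₀))
    (hc : (fun ε => c ε - ϑ) =O[𝓝[>] 0] fun ε : ℝ => ε) {i : ℕ} (hi : i ≤ 2 * r) (n : ℕ) :
    (fun ε => ∫ t in (Metric.ball ϑ δ)ᶜ, |(t - c ε) ^ i| ∂Q ε)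
      =O[𝓝[>] 0] fun ε : ℝ => ε ^ n := by
  have := hQ.isProbability ε₀ hε₀
  have h0 := integrable_one_add_abs_pow ϑ hmom
  refine IsBigO.trans (IsBigO.of_bound' ?_) (hQ.tail _ ε₀ hε₀ h0 n)
  filter_upwards [hQ.eventually_integrable hε₀ h0, hQ.eventually_integrable_sub_pow hε₀ hmom hc,
    eventually_abs_sub_le hc one_pos] with ε h1 h2 h3
  rw [Real.norm_of_nonneg (integral_nonneg fun t => abs_nonneg _),
    Real.norm_of_nonneg (integral_nonneg fun t => abs_nonneg _)]
  exact integral_mono (h2 i hi).abs.integrableOn h1.abs.integrableOn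
    fun t => (abs_sub_pow_le h3 hi).trans (le_abs_self _)

theorem isBigO_scaledMoment (hQ : IsConcentrating Q ϑ δ) (hε₀ : 0 < ε₀)
    (hmom : Integrable (fun t : ℝ => t ^ (2 * r)) (Q ε₀))
    (hc : (fun ε => c ε - ϑ) =O[𝓝[>] 0] fun ε : ℝ => ε) {i : ℕ} (hi : i ≤ 2 * r) :
    (fun ε => scaledMoment (Q ε) (c ε) i) =O[𝓝[>] 0] fun ε : ℝ => ε ^ ((i + 1) / 2) := by
  have h1 : (fun ε => ∫ t in (Metric.ball ϑ δ)ᶜ, (t - c ε) ^ i ∂Q ε)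
      =O[𝓝[>] 0] fun ε : ℝ => ε ^ ((i + 1) / 2) :=
    IsBigO.trans (IsBigO.of_bound' (Eventually.of_forall fun ε => by
      rw [Real.norm_of_nonneg (integral_nonneg fun t => abs_nonneg ((t - c ε) ^ i))]
      exact abs_integral_le_integral_abs)) (hQ.isBigO_tail_sub_pow hε₀ hmom hc hi _)
  have h2 := ((hQ.isBigO_ball_moment hc i).add h1).const_mul_left (i.factorial : ℝ)⁻¹
  refine h2.congr' ?_ EventuallyEq.rfl
  filter_upwards [hQ.eventually_integrable_sub_pow hε₀ hmom hc] with ε h3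
  rw [integral_add_compl measurableSet_ball (h3 i hi), scaledMoment, inv_mul_eq_div]

theorem scaledMoment_one {P : Measure ℝ} [IsProbabilityMeasure P] (c : ℝ)
    (h : Integrable (fun t => (t - c) ^ 1) P) : scaledMoment P c 1 = mean P - c := by
  have h1 : Integrable (fun t : ℝ => t) P := by
    simpa using (h.add (integrable_const c)).congr
      (Eventually.of_forall fun t => by simp : _ =ᵐ[P] fun t => t)
  simp [scaledMoment, mean, integral_sub h1 (integrable_const c)]

theorem eventually_scaledMoment_one (hQ : IsConcentrating Q ϑ δ) (hr : 1 ≤ r) (hε₀ : 0 < ε₀)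
    (hmom : Integrable (fun t : ℝ => t ^ (2 * r)) (Q ε₀))
    (hc : (fun ε => c ε - ϑ) =O[𝓝[>] 0] fun ε : ℝ => ε) :
    ∀ᶠ ε in 𝓝[>] 0, scaledMoment (Q ε) (c ε) 1 = mean (Q ε) - c ε := by
  filter_upwards [hQ.eventually_integrable_sub_pow hε₀ hmom hc, self_mem_nhdsWithin] with ε h1 hε
  have := hQ.isProbability ε hε
  exact scaledMoment_one (c ε) (h1 1 (by lia))

theorem isBigO_const_sub : (fun _ : ℝ => ϑ - ϑ) =O[𝓝[>] 0] fun ε : ℝ => ε := by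
  simpa using isBigO_zero _ _

/-- The case `i = 1` of the moment orders; it admits the mean as a moving centre. -/
theorem isBigO_mean_sub (hQ : IsConcentrating Q ϑ δ) (hr : 1 ≤ r) (hε₀ : 0 < ε₀)
    (hmom : Integrable (fun t : ℝ => t ^ (2 * r)) (Q ε₀)) :
    (fun ε => mean (Q ε) - ϑ) =O[𝓝[>] 0] fun ε : ℝ => ε := by
  have h1 := hQ.isBigO_scaledMoment hε₀ hmom (c := fun _ => ϑ) isBigO_const_sub
    (i := 1) (by lia)
  refine h1.congr' (hQ.eventually_scaledMoment_one hr hε₀ hmom isBigO_const_sub)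
    (Eventually.of_forall fun ε => by simp)

/-- `C` and the range of `ε` are chosen before `F` and `K`; uniformity in `x` rests on this order.
-/
theorem exists_eventually_abs_integral_sub_le (hQ : IsConcentrating Q ϑ δ) (hε₀ : 0 < ε₀)
    (hmom : Integrable (fun t : ℝ => t ^ (2 * r)) (Q ε₀))
    (hc : (fun ε => c ε - ϑ) =O[𝓝[>] 0] fun ε : ℝ => ε) :
    ∃ C : ℝ, ∀ᶠ ε in 𝓝[>] 0, ∀ (F : ℝ → ℝ) (K : ℝ),
      ContDiffOn ℝ (2 * r + 2 : ℕ) F (Metric.ball ϑ δ) → Integrable F (Q ε) →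
      (∀ i ≤ 2 * r + 2, ∀ t ∈ Metric.ball ϑ δ, |iteratedDeriv i F t| ≤ K) →
      |∫ t, F t ∂Q ε - ∑ i ∈ Finset.range (2 * r + 1),
        scaledMoment (Q ε) (c ε) i * iteratedDeriv i F (c ε)|
        ≤ K * (C * ε ^ (r + 1)) + ∫ t in (Metric.ball ϑ δ)ᶜ, |F t| ∂Q ε := by
  have h1 := (hQ.isBigO_ball_moment hc (2 * r + 1)).norm_left
  have h2 := (hQ.isBigO_ball_moment hc (2 * r + 2)).norm_left
  rw [show (2 * r + 1 + 1) / 2 = r + 1 by lia] at h1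
  rw [show (2 * r + 2 + 1) / 2 = r + 1 by lia] at h2
  have h3 : (fun ε => ∑ i ∈ Finset.range (2 * r + 1),
      ∫ t in (Metric.ball ϑ δ)ᶜ, |(t - c ε) ^ i| ∂Q ε) =O[𝓝[>] 0] fun ε : ℝ => ε ^ (r + 1) :=
    IsBigO.fun_sum fun i hi => hQ.isBigO_tail_sub_pow hε₀ hmom hc
      (by rw [Finset.mem_range] at hi; lia) _
  obtain ⟨C, hC⟩ := ((h1.add h2).add h3).bound
  refine ⟨C, ?_⟩
  filter_upwards [hC, hQ.eventually_integrable_sub_pow hε₀ hmom hc,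
    eventually_abs_sub_le hc hQ.radius_pos, self_mem_nhdsWithin] with ε hCε h4 h5 hε F K hF hint hK
  have := hQ.isProbability ε hε
  have hcb : c ε ∈ Metric.ball ϑ δ := by simpa [Real.dist_eq] using h5
  have hK0 : 0 ≤ K := (abs_nonneg _).trans (hK 0 (by lia) _ hcb)
  refine (abs_integral_sub_taylor_le hcb (even_two_mul r) hF hint h4 hK).trans ?_
  gcongr
  rw [Real.norm_of_nonneg (pow_pos hε (r + 1)).le] at hCε
  exact (le_abs_self _).trans hCε

theorem exists_eventually_abs_expansionError_le (hQ : IsConcentrating Q ϑ δ) (hr : 1 ≤ r)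
    (hε₀ : 0 < ε₀) (hmom : Integrable (fun t : ℝ => t ^ (2 * r)) (Q ε₀))
    {X : Type*} (f : X → ℝ → ℝ) :
    ∃ C : ℝ, ∀ᶠ ε in 𝓝[>] 0, ∀ (x : X) (K : ℝ),
      ContDiffOn ℝ (2 * r + 2 : ℕ) (f x) (Metric.ball ϑ δ) → Integrable (f x) (Q ε) →
      (∀ i ≤ 2 * r + 2, ∀ t ∈ Metric.ball ϑ δ, |iteratedDeriv i (f x) t| ≤ K) →
      |expansionError f (Q ε) 1 (2 * r) ϑ (fun i => scaledMoment (Q ε) ϑ i) x|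
        ≤ K * (C * ε ^ (r + 1)) + ∫ t in (Metric.ball ϑ δ)ᶜ, |f x t| ∂Q ε ∧
      |expansionError f (Q ε) 2 (2 * r) (mean (Q ε))
          (fun i => scaledMoment (Q ε) (mean (Q ε)) i) x|
        ≤ K * (C * ε ^ (r + 1)) + ∫ t in (Metric.ball ϑ δ)ᶜ, |f x t| ∂Q ε := by
  have hm := hQ.isBigO_mean_sub hr hε₀ hmom
  obtain ⟨C₁, hC₁⟩ := hQ.exists_eventually_abs_integral_sub_le hε₀ hmom isBigO_const_sub
  obtain ⟨C₂, hC₂⟩ := hQ.exists_eventually_abs_integral_sub_le hε₀ hmom hm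
  refine ⟨max C₁ C₂, ?_⟩
  filter_upwards [hC₁, hC₂, hQ.eventually_scaledMoment_one hr hε₀ hmom hm, self_mem_nhdsWithin]
    with ε h1 h2 h3 hε x K hF hint hK
  have := hQ.isProbability ε hε
  have hε' : 0 < ε := hε
  have hK0 : 0 ≤ K :=
    (abs_nonneg _).trans (hK 0 (by lia) _ (Metric.mem_ball_self hQ.radius_pos))
  have hsum : ∀ g : ℕ → ℝ, ∑ i ∈ Finset.range (2 * r + 1), g i
      = g 0 + ∑ i ∈ Finset.Icc 1 (2 * r), g i := fun g => by
    rw [Finset.range_eq_Ico, Finset.sum_eq_sum_Ico_succ_bot (by lia)]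
    rfl
  have hsum' : ∀ g : ℕ → ℝ, ∑ i ∈ Finset.Icc 1 (2 * r), g i
      = g 1 + ∑ i ∈ Finset.Icc 2 (2 * r), g i := fun g => by
    rw [← Finset.add_sum_Ioc_eq_sum_Icc (by lia)]
    rfl
  have hzero : ∀ m : ℝ, scaledMoment (Q ε) m 0 = 1 := fun m => by simp [scaledMoment]
  have h4 := h1 (f x) K hF hint hK
  have h5 := h2 (f x) K hF hint hK
  rw [hsum, hzero, one_mul, iteratedDeriv_zero] at h4 h5
  -- About the mean the first moment vanishes, so the sum starts at `2`.
  rw [hsum', h3, sub_self, zero_mul, zero_add] at h5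
  constructor
  · refine h4.trans ?_
    gcongr
    exact le_max_left _ _
  · refine h5.trans ?_
    gcongr
    exact le_max_right _ _

end Moments

end IsConcentrating

/-! ### Concentration of dispersion models and the main theorem -/

theorem IsProperDispersionModel.exists_isConcentrating {Θ : Set ℝ} {d : ℝ → ℝ → ℝ} {a : ℝ → ℝ}
    {ϑ : ℝ} (hΘ : IsOpen Θ) (hQ : IsProperDispersionModel Θ d a)
    (hd : ContDiffOn ℝ 3 (Function.uncurry d) (Θ ×ˢ Θ)) (hϑ : ϑ ∈ Θ)
    (htail : ∀ δ > 0, ∃ c > 0, ∀ t ∈ Θ, δ ≤ |t - ϑ| → c ≤ d t ϑ) :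
    ∃ δ : ℝ, Metric.closedBall ϑ δ ⊆ Θ ∧ IsConcentrating (dispersionLaw Θ d a ϑ) ϑ δ := by
  obtain ⟨α, δ, C, L, hδ, h⟩ := hQ.exists_isLaplacePair hΘ hd hϑ
  have hδ' := Metric.ball_subset_closedBall.trans hδ
  exact ⟨δ, hδ, h.radius_pos, hQ.isProbability ϑ hϑ, hQ.isBigO_setIntegral_ball hΘ hϑ hδ' h,
    fun _ _ hint _ hε hεε => hQ.integrable_law_of_le hΘ hϑ hint hε hεε,
    fun _ _ hε₀ hint n => hQ.isBigO_setIntegral_compl_ball hΘ hϑ hδ' h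
      (htail δ h.radius_pos) hε₀ hint n⟩

theorem ae_mem_dispersionLaw {Θ : Set ℝ} (hΘ : IsOpen Θ) (d : ℝ → ℝ → ℝ) (a : ℝ → ℝ) (ϑ ε : ℝ) :
    ∀ᵐ t ∂dispersionLaw Θ d a ϑ ε, t ∈ Θ :=
  (withDensity_absolutelyContinuous _ _).ae_le (ae_restrict_mem hΘ.measurableSet)

theorem integrable_dispersionLaw_of_bounded {Θ : Set ℝ} (hΘ : IsOpen Θ) {d : ℝ → ℝ → ℝ}
    {a : ℝ → ℝ} {ϑ ε : ℝ} [IsFiniteMeasure (dispersionLaw Θ d a ϑ ε)] {F : ℝ → ℝ} {K : ℝ}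
    (hF : ContinuousOn F Θ) (hK : ∀ t ∈ Θ, |F t| ≤ K) : Integrable F (dispersionLaw Θ d a ϑ ε) :=
  Integrable.of_bound ((hF.aestronglyMeasurable hΘ.measurableSet).mono_ac
    (withDensity_absolutelyContinuous _ _)) K ((ae_mem_dispersionLaw hΘ d a ϑ ε).mono hK)

end LocalMixture

theorem theorem5 {X : Type*} [MeasurableSpace X] (ν : Measure X) [SigmaFinite ν]
    (Θ : Set ℝ) (f : X → ℝ → ℝ) (hf : LocalMixture.IsRegularFamily ν Θ f)
    (d : ℝ → ℝ → ℝ) (a : ℝ → ℝ) (hQ : LocalMixture.IsProperDispersionModel Θ d a)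
    -- the unit deviance is three times continuously differentiable
    (hd : ContDiffOn ℝ 3 (Function.uncurry d) (Θ ×ˢ Θ))
    -- exponentially decreasing tails: the deviance is bounded away from zero off its minimum
    (htail : ∀ ϑ ∈ Θ, ∀ δ > 0, ∃ c > 0, ∀ θ ∈ Θ, δ ≤ |θ - ϑ| → c ≤ d θ ϑ)
    (r : ℕ) (hr : 1 ≤ r)
    -- the moments in the statement exist for small dispersion
    (hmom : ∀ ϑ ∈ Θ, ∃ ε > 0,
      Integrable (fun θ : ℝ => θ ^ (2 * r)) (LocalMixture.dispersionLaw Θ d a ϑ ε)) :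
    -- the mixture as a ratio of integrals
    (∀ ϑ ∈ Θ, ∀ ε > 0, ∀ x : X,
      LocalMixture.mixture f (LocalMixture.dispersionLaw Θ d a ϑ ε) x =
        (∫ θ in Θ, f x θ * LocalMixture.dispersionKernel d ϑ ε θ) /
          ∫ θ in Θ, LocalMixture.dispersionKernel d ϑ ε θ) ∧
    ∃ A M : ℕ → ℝ → ℝ → ℝ, ∀ ϑ ∈ Θ,
      -- the coefficients `A i`
      (∀ i ∈ Finset.Icc 1 (2 * r),
        ((fun ε => A i ϑ ε) =O[𝓝[>] 0] fun ε => ε ^ ((i + 1) / 2)) ∧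
        (fun ε => LocalMixture.scaledMoment (LocalMixture.dispersionLaw Θ d a ϑ ε) ϑ i - A i ϑ ε)
          =O[𝓝[>] 0] fun ε => ε ^ (r + 1)) ∧
      -- the pseudo-mean `M 1`
      (∀ᶠ ε in 𝓝[>] 0, M 1 ϑ ε ∈ Θ) ∧
      ((fun ε => LocalMixture.mean (LocalMixture.dispersionLaw Θ d a ϑ ε) - M 1 ϑ ε)
        =O[𝓝[>] 0] fun ε => ε ^ (r + 1)) ∧
      ((fun ε => M 1 ϑ ε - (ϑ + A 1 ϑ ε)) =O[𝓝[>] 0] fun ε => ε ^ 3) ∧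
      -- the coefficients `M i`
      (∀ i ∈ Finset.Icc 2 (2 * r),
        ((fun ε => M i ϑ ε) =O[𝓝[>] 0] fun ε => ε ^ ((i + 1) / 2)) ∧
        (fun ε => LocalMixture.scaledMoment (LocalMixture.dispersionLaw Θ d a ϑ ε)
            (LocalMixture.mean (LocalMixture.dispersionLaw Θ d a ϑ ε)) i - M i ϑ ε)
          =O[𝓝[>] 0] fun ε => ε ^ (r + 1)) ∧
      -- both expansions for fixed `x` at which the mixture density exists
      (∀ x : X, (∃ ε > 0, Integrable (f x) (LocalMixture.dispersionLaw Θ d a ϑ ε)) →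
        ((fun ε => LocalMixture.expansionError f (LocalMixture.dispersionLaw Θ d a ϑ ε) 1 (2 * r)
            ϑ (fun i => A i ϑ ε) x) =O[𝓝[>] 0] fun ε => ε ^ (r + 1)) ∧
        ((fun ε => LocalMixture.expansionError f (LocalMixture.dispersionLaw Θ d a ϑ ε) 2 (2 * r)
            (M 1 ϑ ε) (fun i => M i ϑ ε) x) =O[𝓝[>] 0] fun ε => ε ^ (r + 1))) ∧
      -- both expansions are uniform in `x` if `f` and all its derivatives are bounded
      ((∀ k : ℕ, ∃ K : ℝ, ∀ x : X, ∀ θ ∈ Θ, |iteratedDeriv k (f x) θ| ≤ K) →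
        ∃ C : ℝ, ∀ᶠ ε in 𝓝[>] 0, ∀ x : X,
          |LocalMixture.expansionError f (LocalMixture.dispersionLaw Θ d a ϑ ε) 1 (2 * r)
            ϑ (fun i => A i ϑ ε) x| ≤ C * ε ^ (r + 1) ∧
          |LocalMixture.expansionError f (LocalMixture.dispersionLaw Θ d a ϑ ε) 2 (2 * r)
            (M 1 ϑ ε) (fun i => M i ϑ ε) x| ≤ C * ε ^ (r + 1)) := by
  -- With exact moments as coefficients the moment errors are identically zero, and `M 1 = ϑ + A 1`
  -- holds exactly once the first moment exists.
  refine ⟨fun ϑ hϑ ε hε x => hQ.mixture_eq_div hf.isOpen hϑ hε f x,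
    fun i ϑ ε => LocalMixture.scaledMoment (LocalMixture.dispersionLaw Θ d a ϑ ε) ϑ i,
    fun i ϑ ε => if i = 1 then LocalMixture.mean (LocalMixture.dispersionLaw Θ d a ϑ ε) else
      LocalMixture.scaledMoment (LocalMixture.dispersionLaw Θ d a ϑ ε)
        (LocalMixture.mean (LocalMixture.dispersionLaw Θ d a ϑ ε)) i, fun ϑ hϑ => ?_⟩
  obtain ⟨δ, hδ, hC⟩ := hQ.exists_isConcentrating hf.isOpen hd hϑ (htail ϑ hϑ)
  obtain ⟨ε₀, hε₀, hmom⟩ := hmom ϑ hϑ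
  have hm := hC.isBigO_mean_sub hr hε₀ hmom
  have hc := LocalMixture.IsConcentrating.isBigO_const_sub (ϑ := ϑ)
  have hball := Metric.ball_subset_closedBall.trans hδ
  have hsmooth : ∀ (x : X) (n : ℕ), ContDiffOn ℝ n (f x) Θ := fun x n =>
    (hf.smooth x).of_le (by exact_mod_cast le_top)
  obtain ⟨C, hE⟩ := hC.exists_eventually_abs_expansionError_le hr hε₀ hmom f
  have hcongr : ∀ (Q : Measure ℝ) (x : X),
      LocalMixture.expansionError f Q 2 (2 * r) (LocalMixture.mean Q)
        (fun i => if i = 1 then LocalMixture.mean Q else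
          LocalMixture.scaledMoment Q (LocalMixture.mean Q) i) x
      = LocalMixture.expansionError f Q 2 (2 * r) (LocalMixture.mean Q)
        (fun i => LocalMixture.scaledMoment Q (LocalMixture.mean Q) i) x := fun Q x => by
    unfold LocalMixture.expansionError
    congr 2
    refine Finset.sum_congr rfl fun i hi => ?_
    rw [Finset.mem_Icc] at hi
    simp only [if_neg (show i ≠ 1 by lia)]
  simp only [if_true, sub_self]
  refine ⟨fun i hi => ⟨?_, isBigO_zero _ _⟩, ?_, isBigO_zero _ _, ?_, fun i hi => ?_,
    fun x hx => ?_, fun hK => ?_⟩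
  · exact hC.isBigO_scaledMoment hε₀ hmom hc (Finset.mem_Icc.1 hi).2
  · filter_upwards [LocalMixture.IsConcentrating.eventually_abs_sub_le hm hC.radius_pos] with ε hε
    exact hball (by simpa [Real.dist_eq] using hε)
  · refine (isBigO_zero _ _).congr' ?_ EventuallyEq.rfl
    filter_upwards [hC.eventually_scaledMoment_one hr hε₀ hmom hc] with ε hε
    rw [hε]
    ring
  · rw [Finset.mem_Icc] at hi
    simp only [if_neg (show i ≠ 1 by lia), sub_self]
    exact ⟨hC.isBigO_scaledMoment hε₀ hmom hm hi.2, isBigO_zero _ _⟩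
  · obtain ⟨ε₁, hε₁, hint⟩ := hx
    -- For a single `x`, compactness of the closed ball inside `Θ` bounds the derivatives; the sum
    -- over orders up to `2r + 2` is a common bound.
    choose K hK0 hK using fun n => LocalMixture.exists_abs_iteratedDeriv_le hf.isOpen
      (hsmooth x n) (isCompact_closedBall ϑ δ) hδ
    obtain ⟨T, hT⟩ := (hC.tail _ ε₁ hε₁ hint (r + 1)).bound
    refine ⟨IsBigO.of_bound ((∑ i ∈ Finset.range (2 * r + 3), K i) * C + T) ?_,
      IsBigO.of_bound ((∑ i ∈ Finset.range (2 * r + 3), K i) * C + T) ?_⟩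
    all_goals
      filter_upwards [hE, hT, hC.eventually_integrable hε₁ hint, self_mem_nhdsWithin]
        with ε hEε hTε hintε hε
      have h1 := hEε x (∑ i ∈ Finset.range (2 * r + 3), K i) ((hsmooth x _).mono hball) hintε
        fun i hi t ht => (hK i t (Metric.ball_subset_closedBall ht)).trans
          (Finset.single_le_sum (fun i _ => hK0 i) (Finset.mem_range.2 (by lia)))
      have h2 := (le_abs_self _).trans hTε
      rw [Real.norm_of_nonneg (pow_pos hε _).le] at h2 ⊢
    · exact h1.1.trans (by linarith)
    · rw [hcongr]
      exact h1.2.trans (by linarith)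
  · choose K hK using hK
    -- The tail of the constant `1` is the mass outside the ball; times the bound on `f` it controls
    -- all tails at once, independently of `x`.
    obtain ⟨T, hT⟩ := (hC.tail (fun _ => 1) ε₀ hε₀
      (by have := hC.isProbability ε₀ hε₀
          exact integrable_const _) (r + 1)).bound
    refine ⟨(∑ i ∈ Finset.range (2 * r + 3), |K i|) * C + |K 0| * T, ?_⟩
    filter_upwards [hE, hT, self_mem_nhdsWithin] with ε hEε hTε hε x
    have := hC.isProbability ε hε
    have hK0 : ∀ t ∈ Θ, |f x t| ≤ |K 0| := fun t ht =>
      (by simpa using hK 0 x t ht : |f x t| ≤ K 0).trans (le_abs_self _)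
    have hint := LocalMixture.integrable_dispersionLaw_of_bounded (d := d) (a := a) (ϑ := ϑ)
      (ε := ε) hf.isOpen (hsmooth x 0).continuousOn hK0
    have h1 := hEε x (∑ i ∈ Finset.range (2 * r + 3), |K i|) ((hsmooth x _).mono hball) hint
      fun i hi t ht => (hK i x t (hball ht)).trans ((le_abs_self _).trans
        (Finset.single_le_sum (f := fun i => |K i|) (fun i _ => abs_nonneg _)
          (Finset.mem_range.2 (by lia))))
    have h2 : ∫ t in (Metric.ball ϑ δ)ᶜ, |f x t| ∂LocalMixture.dispersionLaw Θ d a ϑ ε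
        ≤ |K 0| * (T * ε ^ (r + 1)) := by
      calc _ ≤ ∫ t in (Metric.ball ϑ δ)ᶜ, |K 0| * |(1 : ℝ)|
              ∂LocalMixture.dispersionLaw Θ d a ϑ ε := by
            refine integral_mono_ae hint.abs.integrableOn (integrable_const _) ?_
            filter_upwards [ae_restrict_of_ae
              (LocalMixture.ae_mem_dispersionLaw hf.isOpen d a ϑ ε)] with t ht
            simpa using hK0 t ht
        _ ≤ _ := by
            rw [integral_const_mul]
            rw [Real.norm_of_nonneg (pow_pos hε _).le] at hTε
            exact mul_le_mul_of_nonneg_left ((le_abs_self _).trans hTε) (abs_nonneg _)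
    rw [hcongr]
    exact ⟨h1.1.trans (by linarith), h1.2.trans (by linarith)⟩
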